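/- Let $\mathfrak g$ be a five-dimensional real Lie algebra belonging to Block IV of Mubarakzyanov's list, i.e. isomorphic to one of the algebras $\mathfrak g_{5,19},\dots,\mathfrak g_{5,29}$. That is, $\mathfrak g$ has a basis $e_1,\dots,e_5$ with $[e_2,e_3]=e_1$, $[e_1,e_2]=[e_1,e_3]=[e_1,e_4]=[e_2,e_4]=[e_3,e_4]=0$, and with $([e_1,e_5],[e_2,e_5],[e_3,e_5],[e_4,e_5])$ given by one of the following lines, where $\alpha,\beta,p\in\mathbb R$, $\beta\neq0$, $\varepsilon=\pm1$: - $\mathfrak g_{5,19}$: $\bigl((1+\alpha)e_1,\ e_2,\ \alpha e_3,\ \beta e_4\bigr)$; - $\mathfrak g_{5,20}$: $\bigl((1+\alpha)e_1,\ e_2,\ \alpha e_3,\ e_1+(1+\alpha)e_4\bigr)$; - $\mathfrak g_{5,21}$: $\bigl(2e_1,\ e_2+e_3,\ e_3+e_4,\ e_4\bigr)$; - $\mathfrak g_{5,22}$: $\bigl(0,\ e_3,\ 0,\ e_4\bigr)$; - $\mathfrak g_{5,23}$: $\bigl(2e_1,\ e_2+e_3,\ e_3,\ \beta e_4\bigr)$;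 - $\mathfrak g_{5,24}$: $\bigl(2e_1,\ e_2+e_3,\ e_3,\ \varepsilon e_1+2e_4\bigr)$; - $\mathfrak g_{5,25}$: $\bigl(2pe_1,\ pe_2+e_3,\ -e_2+pe_3,\ \beta e_4\bigr)$; - $\mathfrak g_{5,26}$: $\bigl(2pe_1,\ pe_2+e_3,\ -e_2+pe_3,\ \varepsilon e_1+2pe_4\bigr)$; - $\mathfrak g_{5,27}$: $\bigl(e_1,\ 0,\ e_3+e_4,\ e_1+e_4\bigr)$; - $\mathfrak g_{5,28}$: $\bigl((1+\alpha)e_1,\ \alpha e_2,\ e_3+e_4,\ e_4\bigr)$; - $\mathfrak g_{5,29}$: $\bigl(e_1,\ e_2,\ e_4,\ 0\bigr)$. Then $\mathfrak g$ contains an ideal isomorphic to $\mathfrak g_{3,1}+\mathfrak g_1$, the direct sum of the three-dimensional Heisenberg algebra and the one-dimensional algebra. Moreover, let $M$ be a germ at $p$ of a real-analytic real hypersurface in $\mathbb C^3$ that is homogeneous and associated with $\mathfrak g$: near $p$ there is a realization of $\mathfrak g$ by holomorphic vector fields which are tangent to $M$ (a holomorphic field $X$ being identified with the real field $2\operatorname{Re}X$)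 and whose values at $p$ cover $T_pM$. Then either $M$ is Levi-degenerate at $p$, or there are a real-analytic surface germ $\Gamma\subset\mathbb R^3$ at some point $x$ and a point $q$ with $\operatorname{Re}q=x$ such that $\Gamma$ is affinely homogeneous at $x$ (the affine vector fields tangent to $\Gamma$ near $x$ cover $T_x\Gamma$ by their values at $x$), the tube $\Gamma+i\mathbb R^3$ is Levi-nondegenerate at $q$, and some biholomorphic map between neighbourhoods of $p$ and $q$ sends $p$ to $q$ and the germ of $M$ at $p$ onto the germ of $\Gamma+i\mathbb R^3$ at $q$. -/

import Mathlib

open scoped Topology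

namespace CRHyp

/-! ### Real-analytic hypersurface germs -/

section Hypersurface

variable {V : Type*} [NormedAddCommGroup V] [NormedSpace ℝ V]

/-- `Φ` is a local real-analytic defining function of `N` at the point `p ∈ N`: near `p` the set `N`
is the zero set of `Φ`, and `dΦ(p) ≠ 0`. The tangent space of `N` at a point `z ∈ N` near `p` is then
the kernel of `fderiv ℝ Φ z`. -/
structure IsDefiningFunctionAt (Φ : V → ℝ) (N : Set V) (p : V) : Prop where
  analyticAt : AnalyticAt ℝ Φ p
  map_eq_zero : Φ p = 0
  fderiv_ne_zero : fderiv ℝ Φ p ≠ 0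
  mem_iff : ∀ᶠ z in 𝓝 p, (z ∈ N ↔ Φ z = 0)

end Hypersurface

/-! ### The Levi form -/

/-- The space `ℂ³`; the coordinates `z₁, z₂, w` are numbered `0, 1, 2`. -/
abbrev C3 : Type := Fin 3 → ℂ

/-- The space `ℝ³`. -/
abbrev R3 : Type := Fin 3 → ℝ

/-- The real second differential of `Φ` at `p`. -/
noncomputable def hess (Φ : C3 → ℝ) (p v w : C3) : ℝ :=
  fderiv ℝ (fderiv ℝ Φ) p v w

/-- The Hermitian form `∑ j k, (∂²Φ / ∂z_j ∂z̄_k)(p) v_j w̄_k`, written out through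
`∂/∂z = (∂/∂x - i ∂/∂y) / 2` and `∂/∂z̄ = (∂/∂x + i ∂/∂y) / 2`. -/
noncomputable def leviForm (Φ : C3 → ℝ) (p v w : C3) : ℂ :=
  (1 / 4 : ℂ) *
    (((hess Φ p v w + hess Φ p (Complex.I • v) (Complex.I • w) : ℝ) : ℂ) +
      Complex.I *
        ((hess Φ p v (Complex.I • w) - hess Φ p (Complex.I • v) w : ℝ) : ℂ))

/-- `v` lies in the complex tangent space `T ∩ iT` at `p` of the hypersurface `Φ = 0`. -/
def IsComplexTangent (Φ : C3 → ℝ) (p v : C3) : Prop :=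
  fderiv ℝ Φ p v = 0 ∧ fderiv ℝ Φ p (Complex.I • v) = 0

/-- The Levi form of `Φ = 0` at `p`, i.e. `leviForm Φ p` restricted to the complex tangent space,
has a nonzero kernel. -/
def HasLeviKernel (Φ : C3 → ℝ) (p : C3) : Prop :=
  ∃ v : C3, v ≠ 0 ∧ IsComplexTangent Φ p v ∧
    ∀ w : C3, IsComplexTangent Φ p w → leviForm Φ p v w = 0

/-- The germ at `p` of the real-analytic hypersurface `M` is Levi-degenerate. -/
def LeviDegenerateAt (M : Set C3) (p : C3) : Prop :=
  ∃ Φ : C3 → ℝ, IsDefiningFunctionAt Φ M p ∧ HasLeviKernel Φ p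

/-- The germ at `p` of the real-analytic hypersurface `M` is Levi-nondegenerate. -/
def LeviNondegenerateAt (M : Set C3) (p : C3) : Prop :=
  ∃ Φ : C3 → ℝ, IsDefiningFunctionAt Φ M p ∧ ¬ HasLeviKernel Φ p

/-! ### Local holomorphic equivalence, tubes, affine homogeneity -/

/-- The germ of `M` at `p` is mapped onto the germ of `N` at `q` by a biholomorphic map between
neighbourhoods of `p` and `q` that sends `p` to `q`. -/
def HolomorphicallyEquivalentAt (M : Set C3) (p : C3) (N : Set C3) (q : C3) : Prop :=
  ∃ F : OpenPartialHomeomorph C3 C3,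
    p ∈ F.source ∧ F p = q ∧
    DifferentiableOn ℂ F F.source ∧ DifferentiableOn ℂ F.symm F.target ∧
    ∀ z ∈ F.source, (z ∈ M ↔ F z ∈ N)

/-- The coordinatewise real part. -/
def rePart (z : C3) : R3 := fun j => (z j).re

/-- The tube `Γ + iℝ³` over the base `Γ`. -/
def tube (Γ : Set R3) : Set C3 := {z | rePart z ∈ Γ}

/-- The germ at `x` of the real-analytic surface `Γ ⊆ ℝ³` is affinely homogeneous: the affine vector
fields `y ↦ A y + b` that are tangent to `Γ` near `x` (they form a Lie algebra) cover by their values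
at `x` the whole tangent plane. -/
def AffinelyHomogeneousAt (Γ : Set R3) (x : R3) : Prop :=
  ∃ φ : R3 → ℝ, IsDefiningFunctionAt φ Γ x ∧
    ∀ v : R3, fderiv ℝ φ x v = 0 →
      ∃ X : R3 →ᵃ[ℝ] R3, X x = v ∧ ∀ᶠ y in 𝓝 x, y ∈ Γ → fderiv ℝ φ y (X y) = 0

/-! ### The Lie algebras -/

section LieAlgebras

variable {L : Type*} [LieRing L] [LieAlgebra ℝ L]

/-- Commutation relations of `e₁, …, e₅` (numbered `0, …, 4`): `[e₂, e₃] = e₁`, the other brackets of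
`e₁, …, e₄` vanish, and `[e₁, e₅] = b₁`, `[e₂, e₅] = b₂`, `[e₃, e₅] = b₃`, `[e₄, e₅] = b₄`. -/
structure Relations (e : Fin 5 → L) (b₁ b₂ b₃ b₄ : L) : Prop where
  e12 : ⁅e 0, e 1⁆ = 0
  e13 : ⁅e 0, e 2⁆ = 0
  e14 : ⁅e 0, e 3⁆ = 0
  e23 : ⁅e 1, e 2⁆ = e 0
  e24 : ⁅e 1, e 3⁆ = 0
  e34 : ⁅e 2, e 3⁆ = 0
  e15 : ⁅e 0, e 4⁆ = b₁
  e25 : ⁅e 1, e 4⁆ = b₂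
  e35 : ⁅e 2, e 4⁆ = b₃
  e45 : ⁅e 3, e 4⁆ = b₄

/-- The commutation relations of the algebras `g_{5,19}, …, g_{5,29}`. -/
inductive BlockIVRelations (e : Fin 5 → L) : Prop
  | g19 (α β : ℝ) (hβ : β ≠ 0)
      (h : Relations e ((1 + α) • e 0) (e 1) (α • e 2) (β • e 3))
  | g20 (α : ℝ)
      (h : Relations e ((1 + α) • e 0) (e 1) (α • e 2) (e 0 + (1 + α) • e 3))
  | g21
      (h : Relations e ((2 : ℝ) • e 0) (e 1 + e 2) (e 2 + e 3) (e 3))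
  | g22
      (h : Relations e 0 (e 2) 0 (e 3))
  | g23 (β : ℝ) (hβ : β ≠ 0)
      (h : Relations e ((2 : ℝ) • e 0) (e 1 + e 2) (e 2) (β • e 3))
  | g24 (ε : ℝ) (hε : ε = 1 ∨ ε = -1)
      (h : Relations e ((2 : ℝ) • e 0) (e 1 + e 2) (e 2) (ε • e 0 + (2 : ℝ) • e 3))
  | g25 (p β : ℝ) (hβ : β ≠ 0)
      (h : Relations e ((2 * p) • e 0) (p • e 1 + e 2) (-e 1 + p • e 2) (β • e 3))
  | g26 (p ε : ℝ) (hε : ε = 1 ∨ ε = -1)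
      (h : Relations e ((2 * p) • e 0) (p • e 1 + e 2) (-e 1 + p • e 2)
        (ε • e 0 + (2 * p) • e 3))
  | g27
      (h : Relations e (e 0) 0 (e 2 + e 3) (e 0 + e 3))
  | g28 (α : ℝ)
      (h : Relations e ((1 + α) • e 0) (α • e 1) (e 2 + e 3) (e 3))
  | g29
      (h : Relations e (e 0) (e 1) (e 3) 0)

end LieAlgebras

/-- The real Lie algebra `L` is (isomorphic to) one of `g_{5,19}, …, g_{5,29}`. -/
def IsBlockIV (L : Type*) [LieRing L] [LieAlgebra ℝ L] : Prop :=
  ∃ e : Module.Basis (Fin 5) ℝ L, BlockIVRelations e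

/-- The real Lie algebra `K` is (isomorphic to) `g_{3,1} + g_1`, the direct sum of the Heisenberg
algebra and the one-dimensional algebra. -/
def IsHeisenbergPlusLine (K : Type*) [LieRing K] [LieAlgebra ℝ K] : Prop :=
  ∃ f : Module.Basis (Fin 4) ℝ K,
    ⁅f 1, f 2⁆ = f 0 ∧ ⁅f 0, f 1⁆ = 0 ∧ ⁅f 0, f 2⁆ = 0 ∧
    ⁅f 0, f 3⁆ = 0 ∧ ⁅f 1, f 3⁆ = 0 ∧ ⁅f 2, f 3⁆ = 0

/-- The germ at `p` of the real-analytic hypersurface `M ⊆ ℂ³` is a homogeneous hypersurface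
associated with the Lie algebra `L`: on some neighbourhood `U` of `p` there is a realization `ρ` of
`L` by holomorphic vector fields, tangent to `M`, whose values at `p` cover the tangent space of `M`.
A holomorphic field `f ∂/∂z₁ + g ∂/∂z₂ + h ∂/∂w` is the map `(f, g, h)`, read as the real field
`2 Re (f ∂/∂z₁ + g ∂/∂z₂ + h ∂/∂w)` when it acts on real functions. -/
def IsAssociatedWith (M : Set C3) (p : C3) (L : Type*) [LieRing L] [LieAlgebra ℝ L] : Prop :=
  ∃ Φ : C3 → ℝ, IsDefiningFunctionAt Φ M p ∧
    ∃ (U : Set C3) (ρ : L →ₗ[ℝ] (C3 → C3)),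
      IsOpen U ∧ p ∈ U ∧
      (∀ X : L, DifferentiableOn ℂ (ρ X) U) ∧
      (∀ X Y : L, ∀ z ∈ U, ρ ⁅X, Y⁆ z = VectorField.lieBracket ℂ (ρ X) (ρ Y) z) ∧
      (∀ X : L, ∀ z ∈ M ∩ U, fderiv ℝ Φ z (ρ X z) = 0) ∧
      (∀ v : C3, fderiv ℝ Φ p v = 0 → ∃ X : L, ρ X p = v)

end CRHyp

/-! The eleven algebras enter only through their common shape. The span `H` of the first four basis
vectors is an ideal isomorphic to g_{3,1} + g_1, its centre, spanned by `e 0` and `e 3`, is an ideal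
of `L`, and the derived algebra of `H` is the line of `e 0` (`BlockIVRelations.exists_relations`,
`IsAdaptedBasis`).

Since dim `L` = 5 = dim of the tangent space of `M` at `p`, evaluation at `p` is injective on `L`.
Suppose first that `e 0` and `e 3` have ℂ-dependent values at `p`. The ratio is nonreal by
injectivity, so the complex line through the value of `e 0` is tangent to `M`. Differentiating the
tangency condition expresses the Hessian of `Φ` through derivatives of the fields, and because the
centre of `H` is an ideal, that line lies in the Levi kernel (`leviDegenerateAt`).

Otherwise some `x` among `e 1`, `e 2` has a value outside the complex plane of `e 0` and `e 3`,
since otherwise the commutation relations would make [`e 1`, `e 2`] = `e 0` vanish at `p`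
(`not_mem_span_pair`). Then `x`, `e 0`, `e 3` form a commuting holomorphic frame, which a
biholomorphism turns into constant imaginary fields (`exists_straightening`), and `M` becomes a
tube. Let `A` be the span of the frame. Then [`A`, [`A`, `L`]] lies in [`H`, `H`], hence in `A`.
This forces the real part of every pushed-forward field to be affine along ℝ³
(`reCLM_push_realEmb`), and these affine fields make the base homogeneous.

Three analytic tools are proved along the way: Osgood's lemma, the bound of a function vanishing on
`M` by a multiple of `Φ`, and the holomorphic invariance of the Levi form. -/

namespace CRHyp

/-! ### Holomorphic maps of several variables are analytic -/

section Osgood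

open MeasureTheory Metric Complex
open scoped Real BoundedContinuousFunction

variable {E : Type*} [NormedAddCommGroup E] [NormedSpace ℂ E]

theorem norm_torusMap_sub {n : ℕ} (c : Fin n → ℂ) {R : ℝ} (hR : 0 < R) (θ : Fin n → ℝ) (i : Fin n) :
    ‖torusMap c (fun _ => R) θ i - c i‖ = R := by
  simp [torusMap, abs_of_pos hR]

theorem torusMap_mem_closedBall {n : ℕ} (c : Fin n → ℂ) {R : ℝ} (hR : 0 < R) (θ : Fin n → ℝ) :
    torusMap c (fun _ => R) θ ∈ closedBall c R := by
  rw [mem_closedBall, dist_pi_le_iff hR.le]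
  intro i
  rw [dist_eq_norm, norm_torusMap_sub c hR]

theorem torusMap_sub_ne_zero {n : ℕ} {c z : Fin n → ℂ} {R : ℝ} (hR : 0 < R) (hz : z ∈ ball c R)
    (θ : Fin n → ℝ) (i : Fin n) : torusMap c (fun _ => R) θ i - z i ≠ 0 := by
  intro h
  have h1 := norm_torusMap_sub c hR θ i
  rw [sub_eq_zero.1 h, ← dist_eq_norm] at h1
  have h2 : dist (z i) (c i) < R := (dist_le_pi_dist z c i).trans_lt hz
  exact h2.ne h1

theorem continuous_torusMap {n : ℕ} (c : Fin n → ℂ) (R : Fin n → ℝ) :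
    Continuous (torusMap c R) := by
  unfold torusMap
  fun_prop

theorem continuous_torusMap_apply {n : ℕ} (c : Fin n → ℂ) (R : Fin n → ℝ) (i : Fin n) :
    Continuous fun θ => torusMap c R θ i :=
  (continuous_apply i).comp (continuous_torusMap c R)

theorem continuous_comp_torusMap {X : Type*} [TopologicalSpace X] {n : ℕ}
    {f : (Fin n → ℂ) → X} {c : Fin n → ℂ} {R : ℝ}
    (hR : 0 < R) (hf : ContinuousOn f (closedBall c R)) :
    Continuous fun θ => f (torusMap c (fun _ => R) θ) :=
  hf.comp_continuous (continuous_torusMap c _) (torusMap_mem_closedBall c hR)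

/-- **Cauchy integral formula** on a polydisc. -/
theorem torusIntegral_prod_sub_inv_smul [CompleteSpace E] {n : ℕ} {f : (Fin n → ℂ) → E}
    {c z : Fin n → ℂ} {R : ℝ} (hR : 0 < R) (hf : DifferentiableOn ℂ f (closedBall c R))
    (hz : z ∈ ball c R) :
    torusIntegral (fun w => (∏ i, (w i - z i)⁻¹) • f w) c (fun _ => R) =
      (2 * π * I : ℂ) ^ n • f z := by
  induction n with
  | zero => simp [Subsingleton.elim c z]
  | succ n ih =>
    have hint : TorusIntegrable (fun w => (∏ i, (w i - z i)⁻¹) • f w) c (fun _ => R) := by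
      refine (Continuous.continuousOn ?_).integrableOn_compact isCompact_Icc
      refine Continuous.smul (continuous_finsetProd _ fun i _ => ?_)
        (continuous_comp_torusMap hR hf.continuousOn)
      refine Continuous.inv₀ ?_ fun θ => torusMap_sub_ne_zero hR hz θ i
      exact (continuous_torusMap_apply c _ i).sub continuous_const
    rw [torusIntegral_succ hint]
    have hz' : z ∘ Fin.succ ∈ ball (c ∘ Fin.succ) R := by
      rw [mem_ball, dist_pi_lt_iff hR]
      exact fun i => (dist_le_pi_dist z c i.succ).trans_lt hz
    have hz0 : z 0 ∈ ball (c 0) R := (dist_le_pi_dist z c 0).trans_lt hz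
    have hcons : ∀ x ∈ closedBall (c 0) R, ∀ y ∈ closedBall (c ∘ Fin.succ) R,
        (Fin.cons x y : Fin (n + 1) → ℂ) ∈ closedBall c R := by
      intro x hx y hy
      rw [mem_closedBall, dist_pi_le_iff hR.le]
      intro i
      refine Fin.cases ?_ (fun j => ?_) i
      · simpa using hx
      · simpa using (dist_le_pi_dist y (c ∘ Fin.succ) j).trans hy
    -- For a fixed first coordinate on the circle, the inner integral is the formula in `n`
    -- variables for a slice of `f`; the one-variable Cauchy formula then finishes.
    have inner : ∀ x ∈ sphere (c 0) R,
        torusIntegral (fun y => (∏ i, ((Fin.cons x y : Fin (n + 1) → ℂ) i - z i)⁻¹) •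
          f (Fin.cons x y)) (c ∘ Fin.succ) ((fun _ => R) ∘ Fin.succ) =
        (x - z 0)⁻¹ • ((2 * π * I : ℂ) ^ n • f (Fin.cons x (z ∘ Fin.succ))) := by
      intro x hx
      have hd : DifferentiableOn ℂ (fun y => f (Fin.cons x y : Fin (n + 1) → ℂ))
          (closedBall (c ∘ Fin.succ) R) := by
        refine hf.comp (g := f) (f := fun y => (Fin.cons x y : Fin (n + 1) → ℂ)) ?_
          fun y hy => hcons x (sphere_subset_closedBall hx) y hy
        refine Differentiable.differentiableOn (differentiable_pi.2 fun i => ?_)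
        refine Fin.cases ?_ (fun j => ?_) i
        · simp
        · simpa using differentiable_apply j
      rw [← ih hd hz', ← torusIntegral_smul]
      refine congrArg (fun g => torusIntegral g (c ∘ Fin.succ) fun _ => R) (funext fun y => ?_)
      simp [Fin.prod_univ_succ, smul_smul, mul_comm]
    rw [circleIntegral.integral_congr hR.le inner]
    have hd : DifferentiableOn ℂ (fun x => (2 * π * I : ℂ) ^ n •
        f (Fin.cons x (z ∘ Fin.succ) : Fin (n + 1) → ℂ)) (closedBall (c 0) R) := by
      refine DifferentiableOn.const_smul (hf.comp (g := f)
        (f := fun x => (Fin.cons x (z ∘ Fin.succ) : Fin (n + 1) → ℂ)) ?_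
          fun x hx => hcons x hx _ (ball_subset_closedBall hz')) _
      refine Differentiable.differentiableOn (differentiable_pi.2 fun i => ?_)
      refine Fin.cases ?_ (fun j => ?_) i
      · simp
      · simp
    rw [hd.circleIntegral_sub_inv_smul hz0, smul_smul, ← pow_succ']
    congr 2
    exact Fin.cons_self_tail z

/-- Coordinates of the torus as bounded continuous functions of the angles. -/
noncomputable def torusCoord {n : ℕ} (c : Fin n → ℂ) (R : ℝ) (i : Fin n) : (Fin n → ℝ) →ᵇ ℂ :=
  BoundedContinuousFunction.ofNormedAddCommGroup (fun θ => torusMap c (fun _ => R) θ i)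
    (continuous_torusMap_apply c _ i) (‖c i‖ + |R|) fun θ => by
      refine (norm_add_le _ _).trans ?_
      simp

/-- On the torus this difference has constant modulus `R`, so its inverse is bounded. Invertibility
in the Banach algebra is what makes inversion analytic nearby. -/
theorem isUnit_torusCoord_sub {n : ℕ} (c : Fin n → ℂ) {R : ℝ} (hR : 0 < R) (i : Fin n) :
    IsUnit (torusCoord c R i - algebraMap ℂ ((Fin n → ℝ) →ᵇ ℂ) (c i)) := by
  have hne : ∀ θ : Fin n → ℝ, torusMap c (fun _ => R) θ i - c i ≠ 0 := fun θ h => by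
    have := norm_torusMap_sub c hR θ i
    rw [h, norm_zero] at this
    exact hR.ne this
  let v : (Fin n → ℝ) →ᵇ ℂ := BoundedContinuousFunction.ofNormedAddCommGroup
    (fun θ => (torusMap c (fun _ => R) θ i - c i)⁻¹)
    (((continuous_torusMap_apply c _ i).sub continuous_const).inv₀ hne)
    R⁻¹ fun θ => by rw [norm_inv, norm_torusMap_sub c hR]
  refine IsUnit.of_mul_eq_one v ?_
  ext θ
  exact mul_inv_cancel₀ (hne θ)

/-- **Osgood's lemma**: a map that is complex differentiable near a point of `ℂⁿ` is analytic
there. -/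
theorem analyticAt_of_eventually_differentiableAt [CompleteSpace E] {n : ℕ}
    {f : (Fin n → ℂ) → E} {c : Fin n → ℂ} (hf : ∀ᶠ z in 𝓝 c, DifferentiableAt ℂ f z) :
    AnalyticAt ℂ f c := by
  obtain ⟨R, hR, hRf⟩ := nhds_basis_closedBall.eventually_iff.1 hf
  have hd : DifferentiableOn ℂ f (closedBall c R) := fun z hz =>
    (hRf hz).differentiableWithinAt
  let J : (Fin n → ℝ) → E := fun θ =>
    (∏ i : Fin n, (R : ℂ) * exp (θ i * I) * I : ℂ) • f (torusMap c (fun _ => R) θ)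
  have hJ : Continuous J := by
    refine Continuous.smul (by fun_prop) (continuous_comp_torusMap hR hd.continuousOn)
  let S : Set (Fin n → ℝ) := Set.Icc 0 fun _ => 2 * π
  have hgJ : ∀ g : (Fin n → ℝ) →ᵇ ℂ, IntegrableOn (fun θ => g θ • J θ) S := fun g =>
    (g.continuous.smul hJ).continuousOn.integrableOn_compact isCompact_Icc
  -- Integration against `J`, the values of `f` weighted by the Jacobian of the torus, is a bounded
  -- functional of the kernel. Analyticity in `z` thus only has to be checked for the Cauchy kernel.
  let ℓ : ((Fin n → ℝ) →ᵇ ℂ) →L[ℂ] E := LinearMap.mkContinuous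
    { toFun := fun g => ∫ θ in S, g θ • J θ
      map_add' := fun g h => by
        simp only [BoundedContinuousFunction.coe_add, Pi.add_apply, add_smul]
        exact integral_add (hgJ g) (hgJ h)
      map_smul' := fun a g => by
        simp only [BoundedContinuousFunction.coe_smul, smul_assoc, RingHom.id_apply]
        exact integral_smul a _ }
    (∫ θ in S, ‖J θ‖) fun g => by
      have h1 : ‖∫ θ in S, g θ • J θ‖ ≤ ∫ θ in S, ‖g‖ * ‖J θ‖ := by
        refine norm_integral_le_of_norm_le ?_ (Filter.Eventually.of_forall fun θ => ?_)
        · exact (continuous_const.mul hJ.norm).continuousOn.integrableOn_compact isCompact_Icc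
        · rw [norm_smul]
          exact mul_le_mul_of_nonneg_right (g.norm_coe_le_norm θ) (norm_nonneg _)
      rw [integral_const_mul, mul_comm] at h1
      exact h1
  let u : (Fin n → ℂ) → Fin n → ((Fin n → ℝ) →ᵇ ℂ) := fun z i =>
    torusCoord c R i - algebraMap ℂ ((Fin n → ℝ) →ᵇ ℂ) (z i)
  have hu : ∀ i, AnalyticAt ℂ (fun z => u z i) c := by
    intro i
    refine analyticAt_const.sub ?_
    have h2 := ((Algebra.linearMap ℂ ((Fin n → ℝ) →ᵇ ℂ)).toContinuousLinearMap.comp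
      (ContinuousLinearMap.proj (R := ℂ) (φ := fun _ : Fin n => ℂ) i)).analyticAt c
    exact h2
  have hk : AnalyticAt ℂ (fun z => ℓ (∏ i, Ring.inverse (u z i))) c := by
    refine (ℓ.analyticAt _).comp (Finset.analyticAt_fun_prod _ fun i _ => ?_)
    exact AnalyticAt.comp (g := Ring.inverse)
      (analyticAt_inverse (isUnit_torusCoord_sub c hR i).unit) (hu i)
  have hunit : ∀ᶠ z in 𝓝 c, ∀ i, IsUnit (u z i) := by
    rw [Filter.eventually_all]
    intro i
    exact (hu i).continuousAt.eventually (Units.isOpen.mem_nhds (isUnit_torusCoord_sub c hR i))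
  refine ((analyticAt_const (v := ((2 * π * I : ℂ) ^ n)⁻¹)).smul hk).congr ?_
  filter_upwards [hunit, ball_mem_nhds c hR] with z hz hzR
  have h3 := torusIntegral_prod_sub_inv_smul hR hd hzR
  have h4 : ℓ (∏ i, Ring.inverse (u z i)) =
      torusIntegral (fun w => (∏ i, (w i - z i)⁻¹) • f w) c (fun _ => R) := by
    change ∫ θ in S, _ = ∫ θ in S, _
    congr 1
    funext θ
    have h5 : (∏ i, Ring.inverse (u z i)) θ = ∏ i, (torusMap c (fun _ => R) θ i - z i)⁻¹ := by
      rw [BoundedContinuousFunction.coe_prod, Finset.prod_apply]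
      refine Finset.prod_congr rfl fun i _ => ?_
      have h6 := congrArg (fun g : (Fin n → ℝ) →ᵇ ℂ => g θ) (Ring.inverse_mul_cancel _ (hz i))
      exact eq_inv_of_mul_eq_one_left h6
    rw [h5, smul_comm]
  rw [Pi.smul_apply', h4, h3, smul_smul, inv_mul_cancel₀, one_smul]
  simp [Real.pi_ne_zero]

end Osgood

/-! ### Functions vanishing on a hypersurface -/

section Vanishing

open Metric

variable {V : Type*} [NormedAddCommGroup V] [NormedSpace ℝ V]
  {W : Type*} [NormedAddCommGroup W] [NormedSpace ℝ W]

/-- A function that vanishes on the regular zero set of `Φ` is bounded by a multiple of `Φ`. -/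
theorem exists_norm_le_mul_of_eq_zero {Φ : V → ℝ} {Φ' : V →L[ℝ] ℝ} {h : V → W} {h' : V →L[ℝ] W}
    {p : V} (hΦ : HasStrictFDerivAt Φ Φ' p) (hp : Φ p = 0) (hΦ' : Φ' ≠ 0)
    (hh : HasStrictFDerivAt h h' p) (hzero : ∀ᶠ z in 𝓝 p, Φ z = 0 → h z = 0) :
    ∃ C : ℝ, 0 ≤ C ∧ ∀ᶠ z in 𝓝 p, ‖h z‖ ≤ C * ‖Φ z‖ := by
  obtain ⟨v, hv⟩ : ∃ v, Φ' v = 1 := by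
    obtain ⟨v, hv⟩ := ContinuousLinearMap.exists_ne_zero hΦ'
    exact ⟨(Φ' v)⁻¹ • v, by simp [hv]⟩
  obtain ⟨K, s, hs, hK⟩ := hh.exists_lipschitzOnWith
  obtain ⟨K', s', hs', hK'⟩ := hΦ.exists_lipschitzOnWith
  -- Chosen so that moving by `τ • v` changes `Φ` by `τ` up to an error of at most `|τ| / 2`.
  set c : ℝ := (2 * (‖v‖ + 1))⁻¹ with hc
  have hcpos : 0 < c := by positivity
  have hcv : c * ‖v‖ ≤ 1 / 2 := by
    rw [hc, inv_mul_le_iff₀ (by positivity)]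
    linarith
  have hstrict := hΦ.isLittleO.def hcpos
  rw [nhds_prod_eq, Filter.eventually_prod_self_iff'] at hstrict
  obtain ⟨t, ht, htΦ⟩ := hstrict
  obtain ⟨r, hr, hrs⟩ := Metric.mem_nhds_iff.1
    (Filter.inter_mem (Filter.inter_mem hs hs') (Filter.inter_mem ht hzero))
  refine ⟨K * (2 * ‖v‖), by positivity, ?_⟩
  have hsmall : ∀ᶠ z in 𝓝 p, 2 * ‖Φ z‖ * ‖v‖ < r / 2 := by
    have : Filter.Tendsto (fun z => 2 * ‖Φ z‖ * ‖v‖) (𝓝 p) (𝓝 (2 * ‖Φ p‖ * ‖v‖)) :=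
      ((hΦ.continuousAt.norm).const_mul 2).mul_const _
    refine this.eventually (gt_mem_nhds ?_)
    rw [hp]
    simpa using hr
  filter_upwards [hsmall, ball_mem_nhds p (half_pos hr)] with z hz hzr
  set a : ℝ := 2 * ‖Φ z‖ with ha
  have ha0 : 0 ≤ a := by positivity
  have hball : ∀ τ ∈ Set.Icc (-a) a, z + τ • v ∈ ball p r := by
    intro τ hτ
    have h1 : ‖τ • v‖ < r / 2 := by
      rw [norm_smul]
      refine lt_of_le_of_lt ?_ hz
      gcongr
      exact abs_le.2 hτ
    rw [mem_ball, dist_eq_norm] at hzr ⊢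
    calc ‖z + τ • v - p‖ = ‖(z - p) + τ • v‖ := by congr 1; abel
      _ ≤ ‖z - p‖ + ‖τ • v‖ := norm_add_le _ _
      _ < r := by linarith
  have hz0 : z ∈ ball p r := ball_subset_ball (by linarith) hzr
  have hest : ∀ τ ∈ Set.Icc (-a) a, |Φ (z + τ • v) - Φ z - τ| ≤ |τ| / 2 := by
    intro τ hτ
    have h1 := htΦ _ (hrs (hball τ hτ)).2.1 _ (hrs hz0).2.1
    simp only [add_sub_cancel_left, map_smul, hv, smul_eq_mul, mul_one, norm_smul,
      Real.norm_eq_abs] at h1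
    calc _ ≤ c * (|τ| * ‖v‖) := h1
      _ = (c * ‖v‖) * |τ| := by ring
      _ ≤ 1 / 2 * |τ| := by gcongr
      _ = |τ| / 2 := by ring
  have hcont : ContinuousOn (fun τ : ℝ => Φ (z + τ • v)) (Set.Icc (-a) a) := by
    refine ContinuousOn.comp (g := Φ) (hK'.continuousOn) (by fun_prop)
      fun τ hτ => (hrs (hball τ hτ)).1.2
  have hneg := hest (-a) ⟨le_rfl, by linarith⟩
  have hpos := hest a ⟨by linarith, le_rfl⟩
  rw [abs_neg, abs_of_nonneg ha0, abs_le] at hneg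
  rw [abs_of_nonneg ha0, abs_le] at hpos
  have hΦa : |Φ z| = a / 2 := by rw [ha, Real.norm_eq_abs]; ring
  have h1 := le_abs_self (Φ z)
  have h2 := neg_abs_le (Φ z)
  -- As `|Φ z| = a / 2`, the value of `Φ` is at most 0 at `-a` and at least 0 at `a`. So a zero lies
  -- within `a * ‖v‖` of `z`, and the Lipschitz bound for `h` applies.
  obtain ⟨τ, hτ, hτ0⟩ := intermediate_value_Icc (by linarith : -a ≤ a) hcont
    (show (0 : ℝ) ∈ Set.Icc _ _ from ⟨by linarith [hneg.2], by linarith [hpos.1]⟩)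
  have h3 : h (z + τ • v) = 0 := (hrs (hball τ hτ)).2.2 hτ0
  have h4 := hK.norm_sub_le (hrs hz0).1.1 (hrs (hball τ hτ)).1.1
  rw [h3, sub_zero] at h4
  refine h4.trans ?_
  have h5 : ‖z - (z + τ • v)‖ ≤ a * ‖v‖ := by
    rw [sub_add_cancel_left, norm_neg, norm_smul]
    gcongr
    exact abs_le.2 hτ
  calc (K : ℝ) * ‖z - (z + τ • v)‖ ≤ K * (a * ‖v‖) := by gcongr
    _ = K * (2 * ‖v‖) * ‖Φ z‖ := by rw [ha]; ring

/-- The differential of a function vanishing on the regular zero set of `Φ` kills the tangent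
space. -/
theorem apply_eq_zero_of_eq_zero {Φ : V → ℝ} {Φ' : V →L[ℝ] ℝ} {h : V → W} {h' : V →L[ℝ] W}
    {p : V} (hΦ : HasStrictFDerivAt Φ Φ' p) (hp : Φ p = 0) (hΦ' : Φ' ≠ 0)
    (hh : HasStrictFDerivAt h h' p) (hzero : ∀ᶠ z in 𝓝 p, Φ z = 0 → h z = 0)
    {v : V} (hv : Φ' v = 0) : h' v = 0 := by
  obtain ⟨C, -, hC⟩ := exists_norm_le_mul_of_eq_zero hΦ hp hΦ' hh hzero
  have hline : HasDerivAt (fun t : ℝ => p + t • v) v 0 := by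
    simpa using ((hasDerivAt_id (0 : ℝ)).smul_const v).const_add p
  have hp0 : p + (0 : ℝ) • v = p := by simp
  have h1 : HasDerivAt (fun t : ℝ => Φ (p + t • v)) (Φ' v) 0 :=
    HasFDerivAt.comp_hasDerivAt (0 : ℝ) (by rw [hp0]; exact hΦ.hasFDerivAt) hline
  have h2 : HasDerivAt (fun t : ℝ => h (p + t • v)) (h' v) 0 :=
    HasFDerivAt.comp_hasDerivAt (0 : ℝ) (by rw [hp0]; exact hh.hasFDerivAt) hline
  have htend : Filter.Tendsto (fun t : ℝ => p + t • v) (𝓝 0) (𝓝 p) := by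
    simpa [ContinuousAt, hp0] using hline.continuousAt
  have h0 : h p = 0 := hzero.self_of_nhds hp
  -- Along a tangent line `Φ` is o(t), and `h` is O(`Φ`).
  have h3 : HasDerivAt (fun t : ℝ => h (p + t • v)) 0 0 := by
    rw [hasDerivAt_iff_isLittleO] at h1 ⊢
    simp only [hp0, hp, hv, smul_zero, sub_zero, h0] at h1 ⊢
    refine Asymptotics.IsBigO.trans_isLittleO (Asymptotics.IsBigO.of_bound C ?_) h1
    exact htend.eventually hC
  exact h2.unique h3

/-- If the derivative of `Φ` in the directions `ι y` vanishes on the zero set of `Φ`, then the zero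
set is locally invariant under translations by `ι y`. -/
theorem exists_ball_eq_zero_iff_add {Φ : V → ℝ} {p : V} (hΦ : AnalyticAt ℝ Φ p) (hp : Φ p = 0)
    (hΦ' : fderiv ℝ Φ p ≠ 0) (ι : W →L[ℝ] V)
    (hzero : ∀ᶠ z in 𝓝 p, Φ z = 0 → ∀ y, fderiv ℝ Φ z (ι y) = 0) :
    ∃ r > 0, ∀ z ∈ ball p r, ∀ y, z + ι y ∈ ball p r → (Φ z = 0 ↔ Φ (z + ι y) = 0) := by
  have hfd : AnalyticAt ℝ (fun z => (fderiv ℝ Φ z).comp ι) p :=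
    (((ContinuousLinearMap.compL ℝ W V ℝ).flip ι).analyticAt _).comp hΦ.fderiv
  obtain ⟨C, hC0, hC⟩ := exists_norm_le_mul_of_eq_zero hΦ.hasStrictFDerivAt hp hΦ'
    hfd.hasStrictFDerivAt (by
      filter_upwards [hzero] with z hz h0
      ext y
      exact hz h0 y)
  obtain ⟨r, hr, hrs⟩ := Metric.mem_nhds_iff.1 (hC.and hΦ.eventually_analyticAt)
  have key : ∀ z ∈ ball p r, ∀ y, z + ι y ∈ ball p r → Φ z = 0 → Φ (z + ι y) = 0 := by
    intro z hz y hzy h0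
    have hseg : ∀ t ∈ Set.Icc (0 : ℝ) 1, z + t • ι y ∈ ball p r := fun t ht =>
      (convex_ball p r).add_smul_mem hz hzy ht
    have hline : ∀ t : ℝ, HasDerivAt (fun t : ℝ => z + t • ι y) (ι y) t := fun t => by
      simpa using ((hasDerivAt_id t).smul_const (ι y)).const_add z
    have hder : ∀ t ∈ Set.Icc (0 : ℝ) 1, HasDerivAt (fun t : ℝ => Φ (z + t • ι y))
        (fderiv ℝ Φ (z + t • ι y) (ι y)) t := fun t ht =>
      (hrs (hseg t ht)).2.differentiableAt.hasFDerivAt.comp_hasDerivAt t (hline t)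
    -- Grönwall's argument: along the segment the derivative of `Φ` is bounded by a multiple of
    -- `|Φ|`, and `Φ` starts at 0.
    have := eq_zero_of_abs_deriv_le_mul_abs_self_of_eq_zero_right
      (f := fun t : ℝ => Φ (z + t • ι y)) (f' := fun t => fderiv ℝ Φ (z + t • ι y) (ι y))
      (K := C * ‖y‖) (a := 0) (b := 1)
      (fun t ht => (hder t ht).continuousAt.continuousWithinAt)
      (fun t ht => (hder t (Set.Ico_subset_Icc_self ht)).hasDerivWithinAt)
      (by simpa using h0)
      (fun t ht => by
        have h1 := (hrs (hseg t (Set.Ico_subset_Icc_self ht))).1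
        calc _ = ‖((fderiv ℝ Φ (z + t • ι y)).comp ι) y‖ := rfl
          _ ≤ ‖(fderiv ℝ Φ (z + t • ι y)).comp ι‖ * ‖y‖ := ContinuousLinearMap.le_opNorm _ _
          _ ≤ (C * ‖Φ (z + t • ι y)‖) * ‖y‖ := by gcongr
          _ = C * ‖y‖ * ‖Φ (z + t • ι y)‖ := by ring)
      1 ⟨zero_le_one, le_rfl⟩
    simpa using this
  refine ⟨r, hr, fun z hz y hzy => ⟨key z hz y hzy, fun h0 => ?_⟩⟩
  have := key (z + ι y) hzy (-y) (by simpa using hz) h0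
  simpa using this

end Vanishing

/-! ### Holomorphic changes of coordinates -/

section Levi

theorem fderiv_comp_holomorphic_apply {Ψ : C3 → ℝ} {F : C3 → C3} {z : C3}
    (hΨ : DifferentiableAt ℝ Ψ (F z)) (hF : DifferentiableAt ℂ F z) (v : C3) :
    fderiv ℝ (fun z => Ψ (F z)) z v = fderiv ℝ Ψ (F z) (fderiv ℂ F z v) := by
  exact congrArg (fun l : C3 →L[ℝ] ℝ => l v)
    (hΨ.hasFDerivAt.comp z (hF.hasFDerivAt.restrictScalars ℝ)).fderiv

theorem hess_apply {Φ : C3 → ℝ} {p : C3} (hΦ : AnalyticAt ℝ Φ p) (v w : C3) :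
    hess Φ p v w = fderiv ℝ (fun z => fderiv ℝ Φ z w) p v := by
  rw [hess, (hΦ.fderiv.differentiableAt.hasFDerivAt.clm_apply (hasFDerivAt_const w p)).fderiv]
  simp

theorem hess_comm {Φ : C3 → ℝ} {p : C3} (hΦ : AnalyticAt ℝ Φ p) (v w : C3) :
    hess Φ p v w = hess Φ p w v :=
  (hΦ.contDiffAt (n := ⊤)).isSymmSndFDerivAt (by simp) v w

theorem hess_comp_holomorphic {Ψ : C3 → ℝ} {F : C3 → C3} {p : C3}
    (hΨ : AnalyticAt ℝ Ψ (F p)) (hF : AnalyticAt ℂ F p) (v w : C3) :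
    hess (fun z => Ψ (F z)) p v w = hess Ψ (F p) (fderiv ℂ F p v) (fderiv ℂ F p w) +
      fderiv ℝ Ψ (F p) (fderiv ℂ (fderiv ℂ F) p v w) := by
  have hFR : AnalyticAt ℝ F p := hF.restrictScalars
  rw [hess_apply (hΨ.fun_comp hFR)]
  have h1 : (fun z => fderiv ℝ (fun z => Ψ (F z)) z w) =ᶠ[𝓝 p]
      fun z => fderiv ℝ Ψ (F z) (fderiv ℂ F z w) := by
    filter_upwards [hF.continuousAt.eventually hΨ.eventually_analyticAt, hF.eventually_analyticAt]
      with z hz hz'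
    exact fderiv_comp_holomorphic_apply hz.differentiableAt hz'.differentiableAt w
  rw [h1.fderiv_eq]
  have h2 : HasFDerivAt (fun z => fderiv ℂ F z w)
      (((fderiv ℂ (fderiv ℂ F) p).flip w).restrictScalars ℝ) p := by
    have := hF.fderiv.differentiableAt.hasFDerivAt.clm_apply (hasFDerivAt_const w p)
    refine HasFDerivAt.restrictScalars ℝ (this.congr_fderiv ?_)
    ext
    simp
  have h3 : HasFDerivAt (fun z => fderiv ℝ Ψ (F z))
      ((fderiv ℝ (fderiv ℝ Ψ) (F p)).comp ((fderiv ℂ F p).restrictScalars ℝ)) p :=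
    hΨ.fderiv.differentiableAt.hasFDerivAt.comp p
      (hF.differentiableAt.hasFDerivAt.restrictScalars ℝ)
  rw [(h3.clm_apply h2).fderiv]
  simp [hess, add_comm]

/-- The Hessian of a composite has an extra term containing the second derivative of `F`. That
derivative is complex bilinear, so its contributions cancel in both the real and the imaginary part
of the Levi form. -/
theorem leviForm_comp_holomorphic {Ψ : C3 → ℝ} {F : C3 → C3} {p : C3}
    (hΨ : AnalyticAt ℝ Ψ (F p)) (hF : AnalyticAt ℂ F p) (v w : C3) :
    leviForm (fun z => Ψ (F z)) p v w =
      leviForm Ψ (F p) (fderiv ℂ F p v) (fderiv ℂ F p w) := by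
  simp only [leviForm, hess_comp_holomorphic hΨ hF, map_smul, smul_apply,
    smul_smul, Complex.I_mul_I, neg_smul, one_smul, map_neg]
  congr 1
  congr 1
  · congr 1
    ring
  · congr 2
    ring

theorem HasLeviKernel.comp_holomorphic {Ψ : C3 → ℝ} {F : C3 → C3} {p : C3}
    (hΨ : AnalyticAt ℝ Ψ (F p)) (hF : AnalyticAt ℂ F p) {T : C3 ≃L[ℂ] C3}
    (hT : fderiv ℂ F p = T) (h : HasLeviKernel Ψ (F p)) :
    HasLeviKernel (fun z => Ψ (F z)) p := by
  have htan : ∀ u, IsComplexTangent (fun z => Ψ (F z)) p u ↔ IsComplexTangent Ψ (F p) (T u) := by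
    intro u
    simp only [IsComplexTangent,
      fderiv_comp_holomorphic_apply hΨ.differentiableAt hF.differentiableAt, hT, map_smul,
      ContinuousLinearEquiv.coe_coe]
  obtain ⟨v, hv, hvt, hker⟩ := h
  refine ⟨T.symm v, by simpa using hv, by simpa [htan] using hvt, fun w hw => ?_⟩
  rw [leviForm_comp_holomorphic hΨ hF, hT]
  simpa using hker (T w) ((htan w).1 hw)

theorem IsDefiningFunctionAt.comp_holomorphic {Ψ : C3 → ℝ} {F : C3 → C3} {p : C3} {M N : Set C3}
    (hΨ : IsDefiningFunctionAt Ψ N (F p)) (hF : AnalyticAt ℂ F p) {T : C3 ≃L[ℂ] C3}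
    (hT : fderiv ℂ F p = T) (hMN : ∀ᶠ z in 𝓝 p, (z ∈ M ↔ F z ∈ N)) :
    IsDefiningFunctionAt (fun z => Ψ (F z)) M p where
  analyticAt := hΨ.analyticAt.fun_comp hF.restrictScalars
  map_eq_zero := hΨ.map_eq_zero
  fderiv_ne_zero h := hΨ.fderiv_ne_zero <| by
    ext v
    have := congrArg (fun l : C3 →L[ℝ] ℝ => l (T.symm v)) h
    simpa [fderiv_comp_holomorphic_apply hΨ.analyticAt.differentiableAt hF.differentiableAt, hT]
      using this
  mem_iff := by
    filter_upwards [hMN, hF.continuousAt.eventually hΨ.mem_iff] with z h1 h2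
    rw [h1, h2]

end Levi

/-! ### The ideal `g_{3,1} + g_1` and its centre -/

section LieAlgebras

variable {L : Type*} [LieRing L] [LieAlgebra ℝ L]

/-- The span of `e₁, …, e₄`. -/
def heisenbergPart (e : Fin 5 → L) : Submodule ℝ L :=
  Submodule.span ℝ (Set.range fun i : Fin 4 => e i.castSucc)

/-- The span of `e₁, e₄`. -/
def centralPart (e : Fin 5 → L) : Submodule ℝ L :=
  Submodule.span ℝ {e 0, e 3}

theorem castSucc_mem_heisenbergPart (e : Fin 5 → L) (i : Fin 4) :
    e i.castSucc ∈ heisenbergPart e :=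
  Submodule.subset_span ⟨i, rfl⟩

theorem mem_heisenbergPart (e : Fin 5 → L) :
    e 0 ∈ heisenbergPart e ∧ e 1 ∈ heisenbergPart e ∧ e 2 ∈ heisenbergPart e ∧
      e 3 ∈ heisenbergPart e :=
  ⟨castSucc_mem_heisenbergPart e 0, castSucc_mem_heisenbergPart e 1,
    castSucc_mem_heisenbergPart e 2, castSucc_mem_heisenbergPart e 3⟩

theorem mem_centralPart (e : Fin 5 → L) : e 0 ∈ centralPart e ∧ e 3 ∈ centralPart e :=
  ⟨Submodule.subset_span (by simp), Submodule.subset_span (by simp)⟩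

theorem centralPart_le_heisenbergPart (e : Fin 5 → L) : centralPart e ≤ heisenbergPart e := by
  refine Submodule.span_le.2 ?_
  rintro x (rfl | rfl)
  exacts [(mem_heisenbergPart e).1, (mem_heisenbergPart e).2.2.2]

/-- The only place where the list of algebras is inspected; afterwards just these four memberships
matter. -/
theorem BlockIVRelations.exists_relations {e : Fin 5 → L} (h : BlockIVRelations e) :
    ∃ b₁ b₂ b₃ b₄ : L, Relations e b₁ b₂ b₃ b₄ ∧ b₁ ∈ centralPart e ∧ b₂ ∈ heisenbergPart e ∧
      b₃ ∈ heisenbergPart e ∧ b₄ ∈ centralPart e := by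
  obtain ⟨c0, c3⟩ := mem_centralPart e
  obtain ⟨-, h1, h2, -⟩ := mem_heisenbergPart e
  have h3 := centralPart_le_heisenbergPart e c3
  have cz := (centralPart e).zero_mem
  have hz := (heisenbergPart e).zero_mem
  have ca := fun {x y} => (centralPart e).add_mem (x := x) (y := y)
  have ha := fun {x y} => (heisenbergPart e).add_mem (x := x) (y := y)
  have cs := fun (r : ℝ) {x} => (centralPart e).smul_mem r (x := x)
  have hs := fun (r : ℝ) {x} => (heisenbergPart e).smul_mem r (x := x)
  have hn := fun {x} => (heisenbergPart e).neg_mem (x := x)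
  cases h with
  | g19 α β _ h => exact ⟨_, _, _, _, h, cs _ c0, h1, hs _ h2, cs _ c3⟩
  | g20 α h => exact ⟨_, _, _, _, h, cs _ c0, h1, hs _ h2, ca c0 (cs _ c3)⟩
  | g21 h => exact ⟨_, _, _, _, h, cs _ c0, ha h1 h2, ha h2 h3, c3⟩
  | g22 h => exact ⟨_, _, _, _, h, cz, h2, hz, c3⟩
  | g23 β _ h => exact ⟨_, _, _, _, h, cs _ c0, ha h1 h2, h2, cs _ c3⟩
  | g24 ε _ h => exact ⟨_, _, _, _, h, cs _ c0, ha h1 h2, h2, ca (cs _ c0) (cs _ c3)⟩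
  | g25 p β _ h =>
    exact ⟨_, _, _, _, h, cs _ c0, ha (hs _ h1) h2, ha (hn h1) (hs _ h2), cs _ c3⟩
  | g26 p ε _ h =>
    exact ⟨_, _, _, _, h, cs _ c0, ha (hs _ h1) h2, ha (hn h1) (hs _ h2),
      ca (cs _ c0) (cs _ c3)⟩
  | g27 h => exact ⟨_, _, _, _, h, c0, hz, ha h2 h3, ca c0 c3⟩
  | g28 α h => exact ⟨_, _, _, _, h, cs _ c0, hs _ h1, ha h2 h3, c3⟩
  | g29 h => exact ⟨_, _, _, _, h, c0, h1, h3, cz⟩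

/-- The span of `e₁, …, e₄` is an ideal, isomorphic to `g_{3,1} + g_1` through the given basis, and
the span of `e₁, e₄` is an ideal as well. -/
structure IsAdaptedBasis (e : Module.Basis (Fin 5) ℝ L) : Prop where
  lie_zero_one : ⁅e 0, e 1⁆ = 0
  lie_zero_two : ⁅e 0, e 2⁆ = 0
  lie_zero_three : ⁅e 0, e 3⁆ = 0
  lie_one_two : ⁅e 1, e 2⁆ = e 0
  lie_one_three : ⁅e 1, e 3⁆ = 0
  lie_two_three : ⁅e 2, e 3⁆ = 0
  lie_mem_centralPart : ∀ Y ∈ centralPart e, ∀ Z, ⁅Y, Z⁆ ∈ centralPart e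
  lie_mem_heisenbergPart : ∀ Y ∈ heisenbergPart e, ∀ Z, ⁅Y, Z⁆ ∈ heisenbergPart e

theorem lie_mem_of_basis {ι κ : Type*} {S : Submodule ℝ L} {g : κ → L} {e : Module.Basis ι ℝ L}
    {T : Submodule ℝ L} (h : ∀ k i, ⁅g k, e i⁆ ∈ S) (hT : T = Submodule.span ℝ (Set.range g))
    {Y : L} (hY : Y ∈ T) (Z : L) : ⁅Y, Z⁆ ∈ S := by
  subst hT
  induction hY using Submodule.span_induction with
  | mem Y hY =>
    obtain ⟨k, rfl⟩ := hY
    have hZ : Z ∈ Submodule.span ℝ (Set.range e) := e.mem_span Z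
    induction hZ using Submodule.span_induction with
    | mem Z hZ =>
      obtain ⟨i, rfl⟩ := hZ
      exact h k i
    | zero => simp
    | add x y _ _ hx hy => rw [lie_add]; exact S.add_mem hx hy
    | smul c x _ hx => rw [lie_smul]; exact S.smul_mem _ hx
  | zero => simp
  | add x y _ _ hx hy => rw [add_lie]; exact S.add_mem hx hy
  | smul c x _ hx => rw [smul_lie]; exact S.smul_mem _ hx

theorem Relations.isAdaptedBasis {e : Module.Basis (Fin 5) ℝ L} {b₁ b₂ b₃ b₄ : L}
    (h : Relations e b₁ b₂ b₃ b₄) (h₁ : b₁ ∈ centralPart e) (h₂ : b₂ ∈ heisenbergPart e)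
    (h₃ : b₃ ∈ heisenbergPart e) (h₄ : b₄ ∈ centralPart e) : IsAdaptedBasis e where
  lie_zero_one := h.e12
  lie_zero_two := h.e13
  lie_zero_three := h.e14
  lie_one_two := h.e23
  lie_one_three := h.e24
  lie_two_three := h.e34
  lie_mem_centralPart Y hY Z := by
    refine lie_mem_of_basis (g := ![e 0, e 3]) (e := e) ?_ ?_ hY Z
    · intro k i
      have h13 : ⁅e 3, e 1⁆ = 0 := by rw [← lie_skew, h.e24, neg_zero]
      have h03 : ⁅e 3, e 0⁆ = 0 := by rw [← lie_skew, h.e14, neg_zero]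
      have h23 : ⁅e 3, e 2⁆ = 0 := by rw [← lie_skew, h.e34, neg_zero]
      fin_cases k <;> fin_cases i <;> simp [h.e12, h.e13, h.e14, h.e15, h.e45, h13, h03, h23, h₁, h₄]
    · simp [centralPart, Matrix.range_cons, Set.pair_comm]
  lie_mem_heisenbergPart Y hY Z := by
    refine lie_mem_of_basis (g := fun i : Fin 4 => e i.castSucc) (e := e) ?_ rfl hY Z
    intro k i
    have h0 := (mem_heisenbergPart e).1
    have h10 : ⁅e 1, e 0⁆ = 0 := by rw [← lie_skew, h.e12, neg_zero]
    have h20 : ⁅e 2, e 0⁆ = 0 := by rw [← lie_skew, h.e13, neg_zero]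
    have h21 : ⁅e 2, e 1⁆ = -e 0 := by rw [← lie_skew, h.e23]
    have h13 : ⁅e 3, e 1⁆ = 0 := by rw [← lie_skew, h.e24, neg_zero]
    have h03 : ⁅e 3, e 0⁆ = 0 := by rw [← lie_skew, h.e14, neg_zero]
    have h23 : ⁅e 3, e 2⁆ = 0 := by rw [← lie_skew, h.e34, neg_zero]
    have h₁' := centralPart_le_heisenbergPart e h₁
    have h₄' := centralPart_le_heisenbergPart e h₄
    fin_cases k <;> fin_cases i <;>
      simp [h.e12, h.e13, h.e14, h.e15, h.e23, h.e24, h.e25, h.e34, h.e35, h.e45, h10, h20, h21,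
        h13, h03, h23, h0, h₁', h₂, h₃, h₄']

theorem IsBlockIV.exists_isAdaptedBasis (hL : IsBlockIV L) :
    ∃ e : Module.Basis (Fin 5) ℝ L, IsAdaptedBasis e := by
  obtain ⟨e, he⟩ := hL
  obtain ⟨b₁, b₂, b₃, b₄, h, h₁, h₂, h₃, h₄⟩ := he.exists_relations
  exact ⟨e, h.isAdaptedBasis h₁ h₂ h₃ h₄⟩

theorem IsAdaptedBasis.exists_ideal {e : Module.Basis (Fin 5) ℝ L} (he : IsAdaptedBasis e) :
    ∃ I : LieIdeal ℝ L, IsHeisenbergPlusLine I := by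
  let I : LieIdeal ℝ L :=
    { heisenbergPart (L := L) e with
      lie_mem := fun {x m} hm => by
        rw [← lie_skew]
        exact (heisenbergPart (L := L) e).neg_mem (he.lie_mem_heisenbergPart m hm x) }
  let f : Module.Basis (Fin 4) ℝ I :=
    Module.Basis.span (e.linearIndependent.comp _ (Fin.castSucc_injective 4))
  have hf : ∀ i, (f i : L) = e i.castSucc := fun i =>
    congrArg Subtype.val (Module.Basis.span_apply
      (e.linearIndependent.comp _ (Fin.castSucc_injective 4)) i)
  refine ⟨I, f, ?_⟩
  simp only [Subtype.ext_iff, LieSubmodule.coe_bracket, LieIdeal.coe_bracket_of_module, hf,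
    ZeroMemClass.coe_zero]
  exact ⟨he.lie_one_two, he.lie_zero_one, he.lie_zero_two, he.lie_zero_three, he.lie_one_three,
    he.lie_two_three⟩

end LieAlgebras

/-! ### Realizations by holomorphic vector fields -/

section Realization

variable {L : Type*} [LieRing L] [LieAlgebra ℝ L]

/-- `ρ` is a realization of `L` on `U ∋ p` by holomorphic vector fields tangent to the hypersurface
`M = {Φ = 0}`, transitive at `p`. -/
structure IsRealizationAt (Φ : C3 → ℝ) (M : Set C3) (p : C3) (U : Set C3)
    (ρ : L →ₗ[ℝ] (C3 → C3)) : Prop where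
  defining : IsDefiningFunctionAt Φ M p
  isOpen : IsOpen U
  mem : p ∈ U
  differentiableOn : ∀ X : L, DifferentiableOn ℂ (ρ X) U
  map_lie : ∀ X Y : L, ∀ z ∈ U, ρ ⁅X, Y⁆ z = VectorField.lieBracket ℂ (ρ X) (ρ Y) z
  tangent : ∀ X : L, ∀ z ∈ M ∩ U, fderiv ℝ Φ z (ρ X z) = 0
  transitive : ∀ v : C3, fderiv ℝ Φ p v = 0 → ∃ X : L, ρ X p = v

theorem IsAssociatedWith.exists_isRealizationAt {M : Set C3} {p : C3}
    (h : IsAssociatedWith M p L) : ∃ Φ U, ∃ ρ : L →ₗ[ℝ] (C3 → C3), IsRealizationAt Φ M p U ρ := by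
  obtain ⟨Φ, h1, U, ρ, h2, h3, h4, h5, h6, h7⟩ := h
  exact ⟨Φ, U, ρ, h1, h2, h3, h4, h5, h6, h7⟩

theorem apply_complex_smul (l : C3 →L[ℝ] ℝ) (c : ℂ) (v : C3) :
    l (c • v) = c.re * l v + c.im * l (Complex.I • v) := by
  have h : c • v = c.re • v + c.im • (Complex.I • v) := by
    ext j
    simp only [Pi.smul_apply, Pi.add_apply, smul_eq_mul, Complex.real_smul]
    rw [← mul_assoc, ← add_mul, Complex.re_add_im]
  rw [h, map_add, map_smul, map_smul, smul_eq_mul, smul_eq_mul]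

namespace IsRealizationAt

variable {Φ : C3 → ℝ} {M : Set C3} {p : C3} {U : Set C3} {ρ : L →ₗ[ℝ] (C3 → C3)}

theorem analyticAt (h : IsRealizationAt Φ M p U ρ) (X : L) {z : C3} (hz : z ∈ U) :
    AnalyticAt ℂ (ρ X) z := by
  refine analyticAt_of_eventually_differentiableAt ?_
  filter_upwards [h.isOpen.mem_nhds hz] with w hw
  exact (h.differentiableOn X).differentiableAt (h.isOpen.mem_nhds hw)

theorem map_lie_apply (h : IsRealizationAt Φ M p U ρ) (X Y : L) {z : C3} (hz : z ∈ U) :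
    ρ ⁅X, Y⁆ z = fderiv ℂ (ρ Y) z (ρ X z) - fderiv ℂ (ρ X) z (ρ Y z) :=
  h.map_lie X Y z hz

theorem mem_hypersurface (h : IsRealizationAt Φ M p U ρ) : p ∈ M :=
  h.defining.mem_iff.self_of_nhds.2 h.defining.map_eq_zero

theorem fderiv_apply_eq_zero (h : IsRealizationAt Φ M p U ρ) (X : L) :
    fderiv ℝ Φ p (ρ X p) = 0 :=
  h.tangent X p ⟨h.mem_hypersurface, h.mem⟩

/-- Evaluation at `p` maps `L` onto the kernel of the differential of `Φ`, which also has real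
dimension 5, so it is bijective. -/
theorem eq_zero_of_apply_eq_zero (h : IsRealizationAt Φ M p U ρ) (hL : Module.finrank ℝ L = 5)
    {X : L} (hX : ρ X p = 0) : X = 0 := by
  have : FiniteDimensional ℝ L := Module.finite_of_finrank_pos (by omega)
  let K : Submodule ℝ C3 := (fderiv ℝ Φ p).toLinearMap.ker
  let T : L →ₗ[ℝ] K := ((LinearMap.proj p).comp ρ).codRestrict K fun X => h.fderiv_apply_eq_zero X
  have hK : Module.finrank ℝ K = 5 := by
    have hne : (fderiv ℝ Φ p).toLinearMap ≠ 0 := fun h0 => h.defining.fderiv_ne_zero <| by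
      ext v
      exact LinearMap.congr_fun h0 v
    have h1 := Module.Dual.finrank_ker_add_one_of_ne_zero (f := (fderiv ℝ Φ p).toLinearMap) hne
    have h2 : Module.finrank ℝ C3 = 6 := by
      rw [Module.finrank_pi_fintype]
      simp [Complex.finrank_real_complex]
    rw [h2] at h1
    exact Nat.succ_injective h1
  have hsurj : Function.Surjective T := by
    rintro ⟨v, hv⟩
    obtain ⟨X, hX⟩ := h.transitive v hv
    exact ⟨X, Subtype.ext hX⟩
  have hinj : Function.Injective T :=
    (LinearMap.injective_iff_surjective_of_finrank_eq_finrank (hL.trans hK.symm)).2 hsurj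
  exact hinj (by rw [map_zero]; exact Subtype.ext hX)

theorem eventually_tangent (h : IsRealizationAt Φ M p U ρ) :
    ∀ᶠ z in 𝓝 p, Φ z = 0 → ∀ X, fderiv ℝ Φ z (ρ X z) = 0 := by
  filter_upwards [h.defining.mem_iff, h.isOpen.mem_nhds h.mem] with z hz hzU h0 X
  exact h.tangent X z ⟨hz.2 h0, hzU⟩

/-- The function `fderiv ℝ Φ z (ρ X z)` vanishes on `M`, so its derivative in a tangent direction
`w` is zero; the product rule gives the formula. -/
theorem hess_apply_eq (h : IsRealizationAt Φ M p U ρ) (X : L) {w : C3}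
    (hw : fderiv ℝ Φ p w = 0) :
    hess Φ p (ρ X p) w = -fderiv ℝ Φ p (fderiv ℂ (ρ X) p w) := by
  have hΦ := h.defining.analyticAt
  have hX : AnalyticAt ℂ (ρ X) p := h.analyticAt X h.mem
  have hstrict : HasStrictFDerivAt (fun z => fderiv ℝ Φ z (ρ X z)) _ p :=
    hΦ.fderiv.hasStrictFDerivAt.clm_apply
      (hX.hasStrictFDerivAt.restrictScalars ℝ)
  have key := apply_eq_zero_of_eq_zero hΦ.hasStrictFDerivAt h.defining.map_eq_zero
    h.defining.fderiv_ne_zero hstrict (by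
      filter_upwards [h.eventually_tangent] with z hz h0
      exact hz h0 X) hw
  rw [hess_comm hΦ, eq_neg_iff_add_eq_zero, hess, ← key]
  simp [add_comm]

/-- If the values at `p` of the ideal spanned by `e₁, e₄` lie in a complex line, then the
hypersurface is Levi-degenerate at `p`. -/
theorem leviDegenerateAt (h : IsRealizationAt Φ M p U ρ) {e : Module.Basis (Fin 5) ℝ L}
    (he : IsAdaptedBasis e) {c : ℂ} (hc : c.im ≠ 0) (h0 : ρ (e 0) p ≠ 0)
    (h3 : ρ (e 3) p = c • ρ (e 0) p) : LeviDegenerateAt M p := by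
  set v := ρ (e 0) p with hv
  set l := fderiv ℝ Φ p
  have hlv : l v = 0 := h.fderiv_apply_eq_zero _
  have hlIv : l (Complex.I • v) = 0 := by
    have h1 : l (c • v) = 0 := by rw [← h3]; exact h.fderiv_apply_eq_zero _
    rw [apply_complex_smul, hlv, mul_zero, zero_add] at h1
    exact (mul_eq_zero.1 h1).resolve_left hc
  have hline : ∀ a : ℂ, l (a • v) = 0 := fun a => by
    rw [apply_complex_smul, hlv, hlIv, mul_zero, mul_zero, add_zero]
  have hbr : ∀ Z, ∃ a : ℂ, ρ ⁅e 0, Z⁆ p = a • v := by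
    intro Z
    obtain ⟨s, t, hst⟩ := Submodule.mem_span_pair.1
      (he.lie_mem_centralPart _ (mem_centralPart e).1 Z)
    refine ⟨s + t * c, ?_⟩
    rw [← hst, map_add, map_smul, map_smul, Pi.add_apply, Pi.smul_apply, Pi.smul_apply, h3,
      ← hv, add_smul, mul_smul]
    rfl
  -- The field of `⁅Y, Z⁆` is tangent too, so `l` does not see the bracket.
  have hswap : ∀ Y Z, l (fderiv ℂ (ρ Y) p (ρ Z p)) = l (fderiv ℂ (ρ Z) p (ρ Y p)) := by
    intro Y Z
    have h1 := h.fderiv_apply_eq_zero ⁅Y, Z⁆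
    rw [h.map_lie_apply Y Z h.mem, map_sub, sub_eq_zero] at h1
    exact h1.symm
  have key : ∀ w, IsComplexTangent Φ p w →
      hess Φ p v w + hess Φ p (Complex.I • v) (Complex.I • w) = 0 := by
    rintro w ⟨hw, hIw⟩
    obtain ⟨X, hX⟩ := h.transitive w hw
    obtain ⟨Y, hY⟩ := h.transitive _ hIw
    have e1 : hess Φ p v w = -l (fderiv ℂ (ρ X) p v) := by
      rw [h.hess_apply_eq _ hw, ← hX, hswap]
    have e2 : hess Φ p v (Complex.I • w) = -l (fderiv ℂ (ρ Y) p v) := by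
      rw [h.hess_apply_eq _ hIw, ← hY, hswap]
    have e3 : hess Φ p (c • v) (Complex.I • w) = -l (fderiv ℂ (ρ Y) p (c • v)) := by
      rw [← h3, h.hess_apply_eq _ hIw, ← hY, hswap]
    -- As `c` is nonreal, `Complex.I • v` is a real combination of `v` and `c • v`, for which `e2`
    -- and `e3` give the Hessian; dividing by `c.im` isolates it.
    have e4 : hess Φ p (Complex.I • v) (Complex.I • w) =
        -l (Complex.I • fderiv ℂ (ρ Y) p v) := by
      have e5 := apply_complex_smul ((fderiv ℝ (fderiv ℝ Φ) p).flip (Complex.I • w)) c v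
      simp only [ContinuousLinearMap.flip_apply] at e5
      simp only [hess] at e2 e3 ⊢
      rw [e5, e2, map_smul (fderiv ℂ (ρ Y) p), apply_complex_smul l] at e3
      refine mul_left_cancel₀ hc ?_
      linarith
    rw [e1, e4, ← neg_add, ← map_add, neg_eq_zero]
    obtain ⟨a, ha⟩ := hbr X
    obtain ⟨b, hb⟩ := hbr Y
    rw [h.map_lie_apply _ _ h.mem, hX, ← hv, sub_eq_iff_eq_add] at ha
    rw [h.map_lie_apply _ _ h.mem, hY, ← hv, sub_eq_iff_eq_add, map_smul] at hb
    rw [ha, hb]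
    -- The two derivatives of `ρ (e 0)` cancel through `I * I = -1`. What is left comes from
    -- brackets in the centre of the Heisenberg part, hence lies on the complex line of `v`, where
    -- `l` vanishes.
    have e6 : a • v + fderiv ℂ (ρ (e 0)) p w +
        Complex.I • (b • v + Complex.I • fderiv ℂ (ρ (e 0)) p w) = (a + Complex.I * b) • v := by
      rw [smul_add, smul_smul, smul_smul, Complex.I_mul_I]
      module
    rw [e6, hline]
  refine ⟨Φ, h.defining, v, h0, ⟨hlv, hlIv⟩, fun w hw => ?_⟩
  -- `key` is the real part of the Levi form; applied to `Complex.I • w` it yields the imaginary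
  -- part.
  have hIw : IsComplexTangent Φ p (Complex.I • w) := by
    refine ⟨hw.2, ?_⟩
    rw [smul_smul, Complex.I_mul_I, neg_smul, one_smul, map_neg, hw.1, neg_zero]
  have k1 := key w hw
  have k2 := key _ hIw
  have k3 : hess Φ p (Complex.I • v) (Complex.I • Complex.I • w) =
      -hess Φ p (Complex.I • v) w := by
    rw [smul_smul, Complex.I_mul_I, neg_smul, one_smul]
    exact map_neg _ _
  rw [k3, ← sub_eq_add_neg] at k2
  simp [leviForm, k1, k2]

/-- The Heisenberg ideal is not tangent at `p` to the complex plane spanned by its centre. -/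
theorem not_mem_span_pair (h : IsRealizationAt Φ M p U ρ) {e : Module.Basis (Fin 5) ℝ L}
    (he : IsAdaptedBasis e) (h0 : ρ (e 0) p ≠ 0) :
    ρ (e 1) p ∉ Submodule.span ℂ {ρ (e 0) p, ρ (e 3) p} ∨
      ρ (e 2) p ∉ Submodule.span ℂ {ρ (e 0) p, ρ (e 3) p} := by
  by_contra! hcon
  obtain ⟨⟨a, b, h1⟩, ⟨c, d, h2⟩⟩ := hcon.imp Submodule.mem_span_pair.1 Submodule.mem_span_pair.1
  have br : ∀ i j, ⁅e i, e j⁆ = 0 →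
      fderiv ℂ (ρ (e j)) p (ρ (e i) p) = fderiv ℂ (ρ (e i)) p (ρ (e j) p) := by
    intro i j hij
    have := h.map_lie_apply (e i) (e j) h.mem
    rw [hij, map_zero, Pi.zero_apply] at this
    exact (sub_eq_zero.1 this.symm)
  have b01 := br 0 1 he.lie_zero_one
  have b02 := br 0 2 he.lie_zero_two
  have b03 := br 0 3 he.lie_zero_three
  have b13 := br 1 3 he.lie_one_three
  have b23 := br 2 3 he.lie_two_three
  have b12 := h.map_lie_apply (e 1) (e 2) h.mem
  rw [he.lie_one_two] at b12
  refine h0 (b12.trans ?_)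
  -- Vanishing brackets move every derivative onto the central fields. Expanding the remaining
  -- arguments leaves terms that cancel because `e 0` and `e 3` commute.
  have x1 : fderiv ℂ (ρ (e 2)) p (ρ (e 1) p) =
      a • fderiv ℂ (ρ (e 0)) p (ρ (e 2) p) + b • fderiv ℂ (ρ (e 3)) p (ρ (e 2) p) := by
    rw [← b02, b23, ← h1, map_add, map_smul, map_smul]
  have x2 : fderiv ℂ (ρ (e 1)) p (ρ (e 2) p) =
      c • fderiv ℂ (ρ (e 0)) p (ρ (e 1) p) + d • fderiv ℂ (ρ (e 3)) p (ρ (e 1) p) := by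
    rw [← b01, b13, ← h2, map_add, map_smul, map_smul]
  rw [x1, x2, ← h1, ← h2]
  simp only [map_add, map_smul, b03]
  module

end IsRealizationAt

end Realization

/-! ### Simultaneous straightening of commuting vector fields -/

section Straightening

variable {V : Fin 3 → C3 → C3} {p : C3}

/-- The linear map sending the standard basis to the frame `V`. -/
noncomputable def frameMap (V : Fin 3 → C3 → C3) (z : C3) : C3 →L[ℂ] C3 :=
  ∑ j, (ContinuousLinearMap.proj (R := ℂ) (φ := fun _ : Fin 3 => ℂ) j).smulRight (V j z)

theorem frameMap_apply (V : Fin 3 → C3 → C3) (z c : C3) :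
    frameMap V z c = ∑ j, c j • V j z := by
  simp [frameMap]

theorem frameMap_single (V : Fin 3 → C3 → C3) (z : C3) (j : Fin 3) :
    frameMap V z (Pi.single j 1) = V j z := by
  rw [frameMap_apply, Finset.sum_eq_single j] <;> simp +contextual

theorem analyticAt_frameMap (hV : ∀ j, AnalyticAt ℂ (V j) p) : AnalyticAt ℂ (frameMap V) p := by
  refine Finset.analyticAt_fun_sum _ fun j _ => ?_
  exact (((ContinuousLinearMap.smulRightL ℂ C3 C3)
    (ContinuousLinearMap.proj (R := ℂ) (φ := fun _ : Fin 3 => ℂ) j)).analyticAt _).comp (hV j)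

theorem fderiv_frameMap_apply (hV : ∀ j, AnalyticAt ℂ (V j) p) (u c : C3) :
    fderiv ℂ (frameMap V) p u c = ∑ j, c j • fderiv ℂ (V j) p u := by
  have h1 : HasFDerivAt (fun z => frameMap V z c) ((fderiv ℂ (frameMap V) p).flip c) p := by
    refine ((analyticAt_frameMap hV).differentiableAt.hasFDerivAt.clm_apply
      (hasFDerivAt_const c p)).congr_fderiv ?_
    ext
    simp
  have h2 : HasFDerivAt (fun z => frameMap V z c) (∑ j, c j • fderiv ℂ (V j) p) p := by
    simp only [frameMap_apply]
    exact HasFDerivAt.fun_sum fun j _ => (hV j).differentiableAt.hasFDerivAt.const_smul (c j)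
  simpa using congrArg (fun l : C3 →L[ℂ] C3 => l u) (h1.unique h2)

theorem isUnit_frameMap (hli : LinearIndependent ℂ fun j => V j p) : IsUnit (frameMap V p) := by
  have hinj : Function.Injective (frameMap V p) := by
    rw [injective_iff_map_eq_zero]
    intro c hc
    rw [frameMap_apply] at hc
    exact funext (Fintype.linearIndependent_iff.1 hli c hc)
  let T : C3 ≃L[ℂ] C3 :=
    (LinearEquiv.ofInjectiveEndo (frameMap V p).toLinearMap hinj).toContinuousLinearEquiv
  refine ⟨ContinuousLinearEquiv.toUnit T, ?_⟩
  ext1 c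
  rfl

/-- The 1-form dual to a commuting frame is closed. -/
theorem fderiv_inverse_frameMap_symm (hV : ∀ j, AnalyticAt ℂ (V j) p)
    (hcomm : ∀ i j, fderiv ℂ (V j) p (V i p) = fderiv ℂ (V i) p (V j p))
    (hA : IsUnit (frameMap V p)) (u v : C3) :
    fderiv ℂ (fun z => Ring.inverse (frameMap V z)) p u v =
      fderiv ℂ (fun z => Ring.inverse (frameMap V z)) p v u := by
  have hAn := analyticAt_frameMap hV
  have hinv : AnalyticAt ℂ (fun z => Ring.inverse (frameMap V z)) p :=
    AnalyticAt.comp (g := Ring.inverse) (analyticAt_inverse hA.unit) hAn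
  have hmul : (fun z => Ring.inverse (frameMap V z) * frameMap V z) =ᶠ[𝓝 p] fun _ => 1 := by
    filter_upwards [hAn.continuousAt.eventually (Units.isOpen.mem_nhds hA)] with z hz
    exact Ring.inverse_mul_cancel _ hz
  -- Differentiating `A⁻¹ A = 1` reduces the symmetry to that of the derivative of the frame on
  -- frame vectors, which is the commutation hypothesis.
  have hder : ∀ x c : C3, fderiv ℂ (fun z => Ring.inverse (frameMap V z)) p x (frameMap V p c) =
      -Ring.inverse (frameMap V p) (fderiv ℂ (frameMap V) p x c) := by
    intro x c
    have h1 := (hinv.differentiableAt.hasFDerivAt.mul' hAn.differentiableAt.hasFDerivAt).unique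
      ((hasFDerivAt_const 1 p).congr_of_eventuallyEq hmul)
    have h2 := congrArg (fun l => l x c) h1
    simp only [add_apply, smul_apply, zero_apply, smul_eq_mul,
      mul_apply_eq_comp, op_smul_eq_mul] at h2
    rw [eq_neg_iff_add_eq_zero, add_comm]
    exact h2
  have hsurj : ∀ x, ∃ c, frameMap V p c = x := fun x => by
    refine ⟨Ring.inverse (frameMap V p) x, ?_⟩
    exact congrArg (fun l : C3 →L[ℂ] C3 => l x) (Ring.mul_inverse_cancel _ hA)
  obtain ⟨a, rfl⟩ := hsurj u
  obtain ⟨c, rfl⟩ := hsurj v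
  rw [hder, hder, fderiv_frameMap_apply hV, fderiv_frameMap_apply hV]
  congr 2
  simp only [frameMap_apply, map_sum, map_smul, Finset.smul_sum]
  rw [Finset.sum_comm]
  refine Finset.sum_congr rfl fun i _ => Finset.sum_congr rfl fun j _ => ?_
  rw [hcomm, smul_comm]

/-- A commuting holomorphic frame is straightened by a biholomorphic map. -/
theorem exists_straightening (hV : ∀ j, ∀ᶠ z in 𝓝 p, DifferentiableAt ℂ (V j) z)
    (hcomm : ∀ᶠ z in 𝓝 p, ∀ i j, fderiv ℂ (V j) z (V i z) = fderiv ℂ (V i) z (V j z))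
    (hli : LinearIndependent ℂ fun j => V j p) :
    ∃ F : OpenPartialHomeomorph C3 C3, p ∈ F.source ∧ F p = 0 ∧
      (∀ z ∈ F.source, AnalyticAt ℂ F z) ∧
      (∀ z ∈ F.source, ∃ T : C3 ≃L[ℂ] C3, fderiv ℂ F z = T) ∧
      ∀ z ∈ F.source, ∀ j, fderiv ℂ F z (V j z) = Complex.I • Pi.single j 1 := by
  have hVan : ∀ᶠ z in 𝓝 p, ∀ j, AnalyticAt ℂ (V j) z := by
    rw [Filter.eventually_all]
    exact fun j => (analyticAt_of_eventually_differentiableAt (hV j)).eventually_analyticAt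
  have hunit : ∀ᶠ z in 𝓝 p, IsUnit (frameMap V z) :=
    (analyticAt_frameMap hVan.self_of_nhds).continuousAt.eventually
      (Units.isOpen.mem_nhds (isUnit_frameMap hli))
  obtain ⟨r, hr, hball⟩ := Metric.mem_nhds_iff.1 (hVan.and (hcomm.and hunit))
  -- The coordinate map is a primitive of this closed form, given by the Poincaré lemma on a ball.
  -- The factor `I` makes the straightened fields imaginary, as a tube requires.
  let ω : C3 → C3 →L[ℂ] C3 := fun z => Complex.I • Ring.inverse (frameMap V z)
  have hωan : ∀ z ∈ Metric.ball p r, AnalyticAt ℂ (fun z => Ring.inverse (frameMap V z)) z :=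
    fun z hz => AnalyticAt.comp (g := Ring.inverse) (analyticAt_inverse (hball hz).2.2.unit)
      (analyticAt_frameMap (hball hz).1)
  have hωd : ∀ z ∈ Metric.ball p r, HasFDerivAt ω
      ((Complex.I • fderiv ℂ (fun z => Ring.inverse (frameMap V z)) z).restrictScalars ℝ) z :=
    fun z hz => ((hωan z hz).differentiableAt.hasFDerivAt.const_smul Complex.I).restrictScalars ℝ
  obtain ⟨f, hf⟩ := (convex_ball p r).exists_forall_hasFDerivAt_of_fderiv_symmetric
    Metric.isOpen_ball (ω := ω)
    (fun z hz => (hωd z hz).differentiableAt.differentiableWithinAt) (fun z hz x y => by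
      rw [(hωd z hz).fderiv]
      simp only [ContinuousLinearMap.coe_restrictScalars', smul_apply]
      rw [fderiv_inverse_frameMap_symm (hball hz).1 (hball hz).2.1 (hball hz).2.2])
  let g : C3 → C3 := fun z => f z - f p
  have hg : ∀ z ∈ Metric.ball p r, HasFDerivAt g (ω z) z := fun z hz => (hf z hz).sub_const _
  have hgan : ∀ z ∈ Metric.ball p r, AnalyticAt ℂ g z := fun z hz => by
    refine analyticAt_of_eventually_differentiableAt ?_
    filter_upwards [Metric.isOpen_ball.mem_nhds hz] with w hw
    exact (hg w hw).differentiableAt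
  have hT : ∀ z ∈ Metric.ball p r, ∃ T : C3 ≃L[ℂ] C3, ω z = T := by
    intro z hz
    have hu : IsUnit (ω z) := by
      exact (Complex.I_ne_zero.isUnit.map (algebraMap ℂ (C3 →L[ℂ] C3))).mul
        (hball hz).2.2.ringInverse
    exact ⟨ContinuousLinearEquiv.ofUnit hu.unit, rfl⟩
  have hp : p ∈ Metric.ball p r := Metric.mem_ball_self hr
  obtain ⟨T, hTp⟩ := hT p hp
  have hstrict : HasStrictFDerivAt g (T : C3 →L[ℂ] C3) p := by
    rw [← hTp, ← (hg p hp).fderiv]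
    exact (hgan p hp).hasStrictFDerivAt
  let F := (hstrict.toOpenPartialHomeomorph g).restrOpen (Metric.ball p r)
    Metric.isOpen_ball
  have hsub : ∀ z ∈ F.source, z ∈ Metric.ball p r := fun z hz => hz.2
  have hFg : (F : C3 → C3) = g := rfl
  refine ⟨F, ⟨hstrict.mem_toOpenPartialHomeomorph_source, hp⟩, ?_, fun z hz => ?_, fun z hz => ?_,
    fun z hz j => ?_⟩
  · rw [hFg]
    exact sub_self _
  · rw [hFg]
    exact hgan z (hsub z hz)
  · rw [hFg, (hg z (hsub z hz)).fderiv]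
    exact hT z (hsub z hz)
  · rw [hFg, (hg z (hsub z hz)).fderiv, ← frameMap_single V z j]
    have := congrArg (fun l : C3 →L[ℂ] C3 => l (Pi.single j 1))
      (Ring.inverse_mul_cancel _ (hball (hsub z hz)).2.2)
    exact congrArg (fun c : C3 => Complex.I • c) this

end Straightening

/-! ### Real and imaginary directions -/

section RealStructure

/-- The inclusion `ℝ³ → ℂ³`. -/
noncomputable def realEmb : R3 →L[ℝ] C3 :=
  ContinuousLinearMap.pi fun j => Complex.ofRealCLM.comp (ContinuousLinearMap.proj j)

/-- The inclusion `iℝ³ → ℂ³`. -/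
noncomputable def imagEmb : R3 →L[ℝ] C3 := Complex.I • realEmb

/-- The real part as a continuous linear map. -/
noncomputable def reCLM : C3 →L[ℝ] R3 :=
  ContinuousLinearMap.pi fun j => Complex.reCLM.comp (ContinuousLinearMap.proj j)

/-- The imaginary part as a continuous linear map. -/
noncomputable def imCLM : C3 →L[ℝ] R3 :=
  ContinuousLinearMap.pi fun j => Complex.imCLM.comp (ContinuousLinearMap.proj j)

@[simp] theorem realEmb_apply (x : R3) (j : Fin 3) : realEmb x j = x j := rfl

theorem imagEmb_apply (x : R3) : imagEmb x = Complex.I • realEmb x := rfl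

@[simp] theorem reCLM_apply (z : C3) (j : Fin 3) : reCLM z j = (z j).re := rfl

@[simp] theorem imCLM_apply (z : C3) (j : Fin 3) : imCLM z j = (z j).im := rfl

theorem realEmb_add_imagEmb (z : C3) : realEmb (reCLM z) + imagEmb (imCLM z) = z := by
  ext j
  have h := Complex.re_add_im (z j)
  rw [mul_comm] at h
  simpa [imagEmb_apply] using h

theorem reCLM_realEmb (x : R3) : reCLM (realEmb x) = x := by
  ext j
  simp

theorem reCLM_imagEmb (x : R3) : reCLM (imagEmb x) = 0 := by
  ext j
  simp [imagEmb_apply]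

theorem reCLM_neg_I_smul (z : C3) : reCLM (-Complex.I • z) = imCLM z := by
  ext j
  simp

theorem imCLM_neg_I_smul (z : C3) : imCLM (-Complex.I • z) = -reCLM z := by
  ext j
  simp

theorem realEmb_eq (x : R3) : realEmb x = -Complex.I • imagEmb x := by
  rw [imagEmb_apply, smul_smul]
  simp

theorem norm_realEmb_reCLM_le (z : C3) : ‖realEmb (reCLM z)‖ ≤ ‖z‖ := by
  rw [pi_norm_le_iff_of_nonneg (norm_nonneg z)]
  intro j
  simpa using (Complex.abs_re_le_norm (z j)).trans (norm_le_pi_norm z j)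

theorem imagEmb_eq_sum (y : R3) :
    imagEmb y = ∑ j, y j • (Complex.I • (Pi.single j 1 : C3)) := by
  ext k
  simp [imagEmb_apply, Finset.sum_apply, Pi.single_apply, mul_comm]

theorem isDefiningFunctionAt_tube {φ : R3 → ℝ} {Γ : Set R3} {q : C3}
    (h : IsDefiningFunctionAt φ Γ (rePart q)) :
    IsDefiningFunctionAt (fun z => φ (reCLM z)) (tube Γ) q where
  analyticAt := AnalyticAt.fun_comp h.analyticAt (reCLM.analyticAt q)
  map_eq_zero := h.map_eq_zero
  fderiv_ne_zero hcon := h.fderiv_ne_zero <| by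
    have h1 : HasFDerivAt (fun z => φ (reCLM z)) _ q :=
      h.analyticAt.differentiableAt.hasFDerivAt.comp q reCLM.hasFDerivAt
    rw [h1.fderiv] at hcon
    ext1 v
    have := congrArg (fun l : C3 →L[ℝ] ℝ => l (realEmb v)) hcon
    simpa only [ContinuousLinearMap.comp_apply, reCLM_realEmb, zero_apply] using this
  mem_iff := reCLM.continuous.continuousAt.eventually h.mem_iff

end RealStructure

/-! ### Pushing a realization forward to straightened coordinates -/

section Pushforward

/-- Derivative of the push-forward of a field along another field that is straightened. -/
theorem fderiv_pushforward {F V Z : C3 → C3} {z c : C3} (hF : AnalyticAt ℂ F z)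
    (hV : DifferentiableAt ℂ V z) (hZ : DifferentiableAt ℂ Z z)
    (hFV : ∀ᶠ w in 𝓝 z, fderiv ℂ F w (V w) = c) :
    fderiv ℂ (fun w => fderiv ℂ F w (Z w)) z (V z) =
      fderiv ℂ F z (VectorField.lieBracket ℂ V Z z) := by
  have hd := hF.fderiv.differentiableAt.hasFDerivAt
  -- Differentiating the identity `dF(V) = c` trades the second derivative of `F` for a derivative
  -- of `V`; by symmetry this supplies the missing half of the bracket.
  have h1 := (hd.clm_apply hV.hasFDerivAt).unique
    ((hasFDerivAt_const c z).congr_of_eventuallyEq hFV)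
  have h2 := congrArg (fun l : C3 →L[ℂ] C3 => l (Z z)) h1
  have hsymm : fderiv ℂ (fderiv ℂ F) z (V z) (Z z) = fderiv ℂ (fderiv ℂ F) z (Z z) (V z) :=
    (hF.contDiffAt (n := ⊤)).isSymmSndFDerivAt (by simp) _ _
  rw [(hd.clm_apply hZ.hasFDerivAt).fderiv]
  simp only [add_apply, ContinuousLinearMap.comp_apply, ContinuousLinearMap.flip_apply,
    zero_apply] at h2 ⊢
  rw [VectorField.lieBracket_eq, map_sub, hsymm, eq_neg_of_add_eq_zero_right h2, sub_eq_add_neg]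

/-- A map with constant derivative on a ball is affine there. -/
theorem eq_add_of_hasFDerivAt_const {W : Type*} [NormedAddCommGroup W] [NormedSpace ℝ W]
    {f : R3 → W} {f' : R3 →L[ℝ] W} {r : ℝ} (hr : 0 < r)
    (hf : ∀ x ∈ Metric.ball (0 : R3) r, HasFDerivAt f f' x) {x : R3}
    (hx : x ∈ Metric.ball (0 : R3) r) : f x = f 0 + f' x := by
  have h := (convex_ball (0 : R3) r).norm_image_sub_le_of_norm_hasFDerivWithin_le' (φ := f')
    (C := 0) (fun y hy => (hf y hy).hasFDerivWithinAt) (fun y _ => by simp)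
    (Metric.mem_ball_self hr) hx
  rw [zero_mul, sub_zero] at h
  have := norm_le_zero_iff.1 h
  rw [sub_sub, sub_eq_zero] at this
  exact this

end Pushforward

/-! ### Tubes over affinely homogeneous bases -/

section Tube

variable {L : Type*} [LieRing L] [LieAlgebra ℝ L]

/-- `F` is a biholomorphic map defined near `p`, with `F p = 0`, that turns the fields `ρ (E y)` into
the constant fields `i y`. -/
structure IsStraightening (Φ : C3 → ℝ) (M : Set C3) (p : C3) (U : Set C3)
    (ρ : L →ₗ[ℝ] (C3 → C3)) (E : R3 →ₗ[ℝ] L) (F : OpenPartialHomeomorph C3 C3) : Prop where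
  realization : IsRealizationAt Φ M p U ρ
  mem_source : p ∈ F.source
  map_eq_zero : F p = 0
  source_subset : F.source ⊆ U
  mem_iff : ∀ z ∈ F.source, (z ∈ M ↔ Φ z = 0)
  analyticAt_defining : ∀ z ∈ F.source, AnalyticAt ℝ Φ z
  analyticAt : ∀ z ∈ F.source, AnalyticAt ℂ F z
  exists_equiv : ∀ z ∈ F.source, ∃ T : C3 ≃L[ℂ] C3, fderiv ℂ F z = T
  fderiv_apply : ∀ z ∈ F.source, ∀ y, fderiv ℂ F z (ρ (E y) z) = imagEmb y

theorem IsRealizationAt.exists_isStraightening {Φ : C3 → ℝ} {M : Set C3} {p : C3} {U : Set C3}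
    {ρ : L →ₗ[ℝ] (C3 → C3)} (h : IsRealizationAt Φ M p U ρ) {b : Fin 3 → L}
    (hcomm : ∀ i j, ⁅b i, b j⁆ = 0) (hli : LinearIndependent ℂ fun j => ρ (b j) p) :
    ∃ F, IsStraightening Φ M p U ρ (Fintype.linearCombination ℝ b) F := by
  have hU := h.isOpen.mem_nhds h.mem
  obtain ⟨F, hp, hFp, han, hT, hF⟩ := exists_straightening (V := fun j => ρ (b j))
    (fun j => by
      filter_upwards [hU] with z hz
      exact (h.analyticAt (b j) hz).differentiableAt)
    (by
      filter_upwards [hU] with z hz i j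
      have := h.map_lie_apply (b i) (b j) hz
      rw [hcomm, map_zero, Pi.zero_apply] at this
      exact sub_eq_zero.1 this.symm) hli
  -- The source is shrunk so that the local properties of `Φ` and `ρ` hold at each of its points.
  obtain ⟨s, hs, hso, hps⟩ := mem_nhds_iff.1 (Filter.inter_mem hU
    (h.defining.mem_iff.and h.defining.analyticAt.eventually_analyticAt))
  refine ⟨F.restrOpen s hso, h, ⟨hp, hps⟩, hFp, fun z hz => (hs hz.2).1,
    fun z hz => (hs hz.2).2.1, fun z hz => (hs hz.2).2.2, fun z hz => han z hz.1,
    fun z hz => hT z hz.1, fun z hz y => ?_⟩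
  rw [imagEmb_eq_sum, Fintype.linearCombination_apply, map_sum, Finset.sum_apply, map_sum]
  refine Finset.sum_congr rfl fun j _ => ?_
  rw [map_smul, Pi.smul_apply, ← hF z hz.1 j]
  exact ((fderiv ℂ F z).restrictScalars ℝ).map_smul (y j) _

namespace IsStraightening

variable {Φ : C3 → ℝ} {M : Set C3} {p : C3} {U : Set C3} {ρ : L →ₗ[ℝ] (C3 → C3)}
  {E : R3 →ₗ[ℝ] L} {F : OpenPartialHomeomorph C3 C3}

/-- The value at `ζ` of the push-forward by `F` of the realization `ρ`. -/
noncomputable def push (F : OpenPartialHomeomorph C3 C3) (ρ : L →ₗ[ℝ] (C3 → C3)) (ζ : C3) :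
    L →ₗ[ℝ] C3 :=
  ((fderiv ℂ F (F.symm ζ)).restrictScalars ℝ).toLinearMap ∘ₗ LinearMap.proj (F.symm ζ) ∘ₗ ρ

theorem push_apply (ζ : C3) (Z : L) :
    push F ρ ζ Z = fderiv ℂ F (F.symm ζ) (ρ Z (F.symm ζ)) := rfl

theorem zero_mem_target (S : IsStraightening Φ M p U ρ E F) : (0 : C3) ∈ F.target := by
  rw [← S.map_eq_zero]
  exact F.map_source S.mem_source

theorem symm_zero (S : IsStraightening Φ M p U ρ E F) : F.symm 0 = p := by
  rw [← S.map_eq_zero]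
  exact F.left_inv S.mem_source

theorem analyticAt_symm (S : IsStraightening Φ M p U ρ E F) {ζ : C3} (hζ : ζ ∈ F.target) :
    AnalyticAt ℂ F.symm ζ := by
  obtain ⟨T, hT⟩ := S.exists_equiv _ (F.map_target hζ)
  exact F.analyticAt_symm hζ (S.analyticAt _ (F.map_target hζ)) hT

theorem fderiv_fderiv_symm (S : IsStraightening Φ M p U ρ E F) {ζ : C3} (hζ : ζ ∈ F.target)
    (v : C3) : fderiv ℂ F (F.symm ζ) (fderiv ℂ F.symm ζ v) = v := by
  have h1 : HasFDerivAt (F ∘ F.symm) _ ζ :=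
    (S.analyticAt _ (F.map_target hζ)).differentiableAt.hasFDerivAt.comp ζ
      (S.analyticAt_symm hζ).differentiableAt.hasFDerivAt
  have h2 : (F ∘ F.symm) =ᶠ[𝓝 ζ] id := F.eventually_right_inverse hζ
  exact congrArg (fun l : C3 →L[ℂ] C3 => l v)
    (h1.unique ((hasFDerivAt_id ζ).congr_of_eventuallyEq h2))

theorem fderiv_symm_fderiv (S : IsStraightening Φ M p U ρ E F) {ζ : C3} (hζ : ζ ∈ F.target)
    (v : C3) : fderiv ℂ F.symm ζ (fderiv ℂ F (F.symm ζ) v) = v := by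
  obtain ⟨T, hT⟩ := S.exists_equiv _ (F.map_target hζ)
  refine T.injective ?_
  have := S.fderiv_fderiv_symm hζ (fderiv ℂ F (F.symm ζ) v)
  rw [hT] at this ⊢
  exact this

theorem exists_equiv_symm (S : IsStraightening Φ M p U ρ E F) {ζ : C3} (hζ : ζ ∈ F.target) :
    ∃ T : C3 ≃L[ℂ] C3, fderiv ℂ F.symm ζ = T := by
  obtain ⟨T, hT⟩ := S.exists_equiv _ (F.map_target hζ)
  refine ⟨T.symm, ?_⟩
  ext1 v
  have := S.fderiv_symm_fderiv hζ (T.symm v)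
  rw [hT] at this
  simpa using this

theorem push_straight (S : IsStraightening Φ M p U ρ E F) {ζ : C3} (hζ : ζ ∈ F.target) (y : R3) :
    push F ρ ζ (E y) = imagEmb y :=
  S.fderiv_apply _ (F.map_target hζ) y

theorem fderiv_symm_push (S : IsStraightening Φ M p U ρ E F) {ζ : C3} (hζ : ζ ∈ F.target)
    (Z : L) : fderiv ℂ F.symm ζ (push F ρ ζ Z) = ρ Z (F.symm ζ) :=
  S.fderiv_symm_fderiv hζ _

/-- Differentiating along a constant field is bracketing with it, so brackets in `L` control the
imaginary directions; complex linearity of `D` then gives the real ones. -/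
theorem hasFDerivAt_push (S : IsStraightening Φ M p U ρ E F) {ζ : C3} (hζ : ζ ∈ F.target)
    (Z : L) : ∃ D : C3 →L[ℂ] C3, HasFDerivAt (fun ξ => push F ρ ξ Z) D ζ ∧
      ∀ y, D (imagEmb y) = push F ρ ζ ⁅E y, Z⁆ := by
  have hs := F.map_target hζ
  have hF := S.analyticAt _ hs
  have hZ := fun Z => (S.realization.analyticAt Z (S.source_subset hs)).differentiableAt
  have hd : DifferentiableAt ℂ (fun w => fderiv ℂ F w (ρ Z w)) (F.symm ζ) :=
    hF.fderiv.differentiableAt.clm_apply (hZ Z)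
  refine ⟨_, hd.hasFDerivAt.comp ζ (S.analyticAt_symm hζ).differentiableAt.hasFDerivAt,
    fun y => ?_⟩
  rw [ContinuousLinearMap.comp_apply, ← S.push_straight hζ y, S.fderiv_symm_push hζ,
    fderiv_pushforward (c := imagEmb y) hF (hZ _) (hZ _), push_apply,
    S.realization.map_lie _ _ _ (S.source_subset hs)]
  filter_upwards [F.open_source.mem_nhds hs] with w hw
  exact S.fderiv_apply w hw y

theorem hasFDerivAt_push_realEmb (S : IsStraightening Φ M p U ρ E F) {x : R3}
    (hx : realEmb x ∈ F.target) (Z : L) :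
    ∃ D : R3 →L[ℝ] C3, HasFDerivAt (fun x => push F ρ (realEmb x) Z) D x ∧
      ∀ y, D y = -Complex.I • push F ρ (realEmb x) ⁅E y, Z⁆ := by
  obtain ⟨D, hD, hDE⟩ := S.hasFDerivAt_push hx Z
  refine ⟨_, (hD.restrictScalars ℝ).comp x realEmb.hasFDerivAt, fun y => ?_⟩
  rw [ContinuousLinearMap.comp_apply, ContinuousLinearMap.coe_restrictScalars', realEmb_eq,
    map_smul, hDE]

/-- The derivative in a real direction is `-I` times an imaginary constant field, hence real, so the
imaginary part does not change. -/
theorem imCLM_push_realEmb (S : IsStraightening Φ M p U ρ E F) {r : ℝ} (hr : 0 < r)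
    (htarget : ∀ x ∈ Metric.ball (0 : R3) r, realEmb x ∈ F.target) {Z : L}
    (hZ : ∀ y, ∃ s, ⁅E y, Z⁆ = E s) {x : R3} (hx : x ∈ Metric.ball (0 : R3) r) :
    imCLM (push F ρ (realEmb x) Z) = imCLM (push F ρ 0 Z) := by
  have h := eq_add_of_hasFDerivAt_const (f := fun x => imCLM (push F ρ (realEmb x) Z)) (f' := 0)
    hr (fun x hx => by
      obtain ⟨D, hD, hDE⟩ := S.hasFDerivAt_push_realEmb (htarget x hx) Z
      refine (imCLM.hasFDerivAt.comp x hD).congr_fderiv ?_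
      ext1 y
      obtain ⟨s, hs⟩ := hZ y
      rw [ContinuousLinearMap.comp_apply, hDE, hs, S.push_straight (htarget x hx),
        imCLM_neg_I_smul, reCLM_imagEmb, neg_zero, zero_apply]) hx
  simpa using h

/-- The derivative of the real part along `y` is the imaginary part of the field of `⁅E y, Z⁆`. By
the double-bracket hypothesis that imaginary part is constant on the real ball. -/
theorem reCLM_push_realEmb (S : IsStraightening Φ M p U ρ E F) {r : ℝ} (hr : 0 < r)
    (htarget : ∀ x ∈ Metric.ball (0 : R3) r, realEmb x ∈ F.target)
    (hE : ∀ y y' Z, ∃ s, ⁅E y, ⁅E y', Z⁆⁆ = E s) (Z : L) :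
    ∃ A : R3 →ₗ[ℝ] R3, ∀ x ∈ Metric.ball (0 : R3) r,
      reCLM (push F ρ (realEmb x) Z) = reCLM (push F ρ 0 Z) + A x := by
  let A : R3 →ₗ[ℝ] R3 :=
    { toFun := fun y => imCLM (push F ρ 0 ⁅E y, Z⁆)
      map_add' := fun y y' => by rw [map_add, add_lie, map_add, map_add]
      map_smul' := fun c y => by
        rw [map_smul, smul_lie, map_smul, map_smul, RingHom.id_apply] }
  refine ⟨A, fun x hx => ?_⟩
  have h := eq_add_of_hasFDerivAt_const (f := fun x => reCLM (push F ρ (realEmb x) Z))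
    (f' := A.toContinuousLinearMap) hr (fun x hx => by
      obtain ⟨D, hD, hDE⟩ := S.hasFDerivAt_push_realEmb (htarget x hx) Z
      refine (reCLM.hasFDerivAt.comp x hD).congr_fderiv ?_
      ext1 y
      rw [ContinuousLinearMap.comp_apply, hDE, reCLM_neg_I_smul,
        S.imCLM_push_realEmb hr htarget (fun y' => hE y' y Z) hx]
      rfl) hx
  simpa using h

theorem fderiv_comp_symm (S : IsStraightening Φ M p U ρ E F) {ζ : C3} (hζ : ζ ∈ F.target)
    (v : C3) : fderiv ℝ (fun ζ => Φ (F.symm ζ)) ζ v =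
      fderiv ℝ Φ (F.symm ζ) (fderiv ℂ F.symm ζ v) :=
  fderiv_comp_holomorphic_apply (S.analyticAt_defining _ (F.map_target hζ)).differentiableAt
    (S.analyticAt_symm hζ).differentiableAt v

theorem fderiv_comp_symm_push (S : IsStraightening Φ M p U ρ E F) {ζ : C3} (hζ : ζ ∈ F.target)
    (h0 : Φ (F.symm ζ) = 0) (Z : L) :
    fderiv ℝ (fun ζ => Φ (F.symm ζ)) ζ (push F ρ ζ Z) = 0 := by
  have hs := F.map_target hζ
  rw [S.fderiv_comp_symm hζ, S.fderiv_symm_push hζ]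
  exact S.realization.tangent Z _ ⟨(S.mem_iff _ hs).2 h0, S.source_subset hs⟩

theorem fderiv_comp_symm_imagEmb (S : IsStraightening Φ M p U ρ E F) {ζ : C3}
    (hζ : ζ ∈ F.target) (h0 : Φ (F.symm ζ) = 0) (y : R3) :
    fderiv ℝ (fun ζ => Φ (F.symm ζ)) ζ (imagEmb y) = 0 := by
  rw [← S.push_straight hζ]
  exact S.fderiv_comp_symm_push hζ h0 _

theorem isDefiningFunctionAt_comp_symm (S : IsStraightening Φ M p U ρ E F) :
    IsDefiningFunctionAt (fun ζ => Φ (F.symm ζ)) (F.symm ⁻¹' M) 0 := by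
  obtain ⟨T, hT⟩ := S.exists_equiv_symm S.zero_mem_target
  refine IsDefiningFunctionAt.comp_holomorphic (N := M) ?_ (S.analyticAt_symm S.zero_mem_target) hT
    (Filter.Eventually.of_forall fun z => Iff.rfl)
  rw [S.symm_zero]
  exact S.realization.defining

theorem fderiv_comp_symm_realEmb (S : IsStraightening Φ M p U ρ E F) {x : R3}
    (hx : realEmb x ∈ F.target) (v : R3) :
    fderiv ℝ (fun x => Φ (F.symm (realEmb x))) x v =
      fderiv ℝ (fun ζ => Φ (F.symm ζ)) (realEmb x) (realEmb v) := by
  have h1 : AnalyticAt ℝ (fun ζ => Φ (F.symm ζ)) (realEmb x) :=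
    (S.analyticAt_defining _ (F.map_target hx)).fun_comp (S.analyticAt_symm hx).restrictScalars
  exact congrArg (fun l : R3 →L[ℝ] ℝ => l v)
    (h1.differentiableAt.hasFDerivAt.comp x realEmb.hasFDerivAt).fderiv

/-- The differential kills all imaginary directions at 0, so being nonzero it is nonzero on ℝ³. -/
theorem isDefiningFunctionAt_base (S : IsStraightening Φ M p U ρ E F) :
    IsDefiningFunctionAt (fun x => Φ (F.symm (realEmb x))) {x | Φ (F.symm (realEmb x)) = 0} 0 := by
  have h := S.isDefiningFunctionAt_comp_symm
  have h0 : realEmb 0 ∈ F.target := by rw [map_zero]; exact S.zero_mem_target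
  refine ⟨?_, ?_, fun hcon => h.fderiv_ne_zero ?_, Filter.Eventually.of_forall fun x => Iff.rfl⟩
  · exact AnalyticAt.fun_comp (g := fun ζ => Φ (F.symm ζ))
      (by rw [map_zero]; exact h.analyticAt) (realEmb.analyticAt 0)
  · rw [map_zero]
    exact h.map_eq_zero
  · ext1 ζ
    rw [← realEmb_add_imagEmb ζ, map_add,
      S.fderiv_comp_symm_imagEmb S.zero_mem_target h.map_eq_zero, add_zero]
    have := S.fderiv_comp_symm_realEmb h0 (reCLM ζ)
    rw [hcon, map_zero] at this
    exact this.symm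

theorem affinelyHomogeneousAt (S : IsStraightening Φ M p U ρ E F)
    (hE : ∀ y y' Z, ∃ s, ⁅E y, ⁅E y', Z⁆⁆ = E s) :
    AffinelyHomogeneousAt {x | Φ (F.symm (realEmb x)) = 0} 0 := by
  refine ⟨_, S.isDefiningFunctionAt_base, fun v hv => ?_⟩
  have h0 : realEmb 0 ∈ F.target := by rw [map_zero]; exact S.zero_mem_target
  obtain ⟨r, hr, hball⟩ := Metric.mem_nhds_iff.1
    (realEmb.continuous.continuousAt.eventually (F.open_target.mem_nhds h0))
  rw [S.fderiv_comp_symm_realEmb h0, map_zero, S.fderiv_comp_symm S.zero_mem_target,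
    S.symm_zero] at hv
  -- Transitivity on `M` yields an element whose pushed-forward field equals `realEmb v` at 0. Its
  -- real part is the affine field sought.
  obtain ⟨Z, hZ⟩ := S.realization.transitive _ hv
  have hpush : push F ρ 0 Z = realEmb v := by
    rw [push_apply, S.symm_zero, hZ]
    have := S.fderiv_fderiv_symm S.zero_mem_target (realEmb v)
    rwa [S.symm_zero] at this
  obtain ⟨A, hA⟩ := S.reCLM_push_realEmb hr (fun x hx => hball hx) hE Z
  refine ⟨A.toAffineMap + AffineMap.const ℝ R3 v, by simp, ?_⟩
  filter_upwards [Metric.ball_mem_nhds (0 : R3) hr] with x hx hxΓ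
  have hxt : realEmb x ∈ F.target := hball hx
  have hval : (A.toAffineMap + AffineMap.const ℝ R3 v) x = reCLM (push F ρ (realEmb x) Z) := by
    rw [hA x hx, hpush, reCLM_realEmb, add_comm]
    rfl
  rw [hval, S.fderiv_comp_symm_realEmb hxt]
  have h1 := S.fderiv_comp_symm_push hxt hxΓ Z
  -- Imaginary directions are tangent, so dropping the imaginary part keeps the field tangent.
  rwa [← realEmb_add_imagEmb (push F ρ (realEmb x) Z), map_add,
    S.fderiv_comp_symm_imagEmb hxt hxΓ, add_zero] at h1

/-- Near 0 the hypersurface is invariant under imaginary translations, so membership of `ζ` is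
decided at its real part, which stays in the same ball. -/
theorem exists_ball_mem_tube_iff (S : IsStraightening Φ M p U ρ E F) :
    ∃ r > 0, Metric.ball (0 : C3) r ⊆ F.target ∧ ∀ ζ ∈ Metric.ball (0 : C3) r,
      (F.symm ζ ∈ M ↔ ζ ∈ tube {x | Φ (F.symm (realEmb x)) = 0}) := by
  have h := S.isDefiningFunctionAt_comp_symm
  obtain ⟨r₁, hr₁, hball₁⟩ := Metric.mem_nhds_iff.1 (F.open_target.mem_nhds S.zero_mem_target)
  obtain ⟨r₂, hr₂, hball₂⟩ := exists_ball_eq_zero_iff_add h.analyticAt h.map_eq_zero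
    h.fderiv_ne_zero imagEmb (by
      filter_upwards [F.open_target.mem_nhds S.zero_mem_target] with ζ hζ h0 y
      exact S.fderiv_comp_symm_imagEmb hζ h0 y)
  refine ⟨min r₁ r₂, lt_min hr₁ hr₂,
    (Metric.ball_subset_ball (min_le_left _ _)).trans hball₁, fun ζ hζ => ?_⟩
  have hζ₁ := hball₁ (Metric.ball_subset_ball (min_le_left _ _) hζ)
  have hζ₂ := Metric.ball_subset_ball (min_le_right r₁ r₂) hζ
  have hre : realEmb (reCLM ζ) ∈ Metric.ball (0 : C3) r₂ := by
    rw [mem_ball_zero_iff] at hζ₂ ⊢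
    exact (norm_realEmb_reCLM_le ζ).trans_lt hζ₂
  have := hball₂ _ hre (imCLM ζ) (by rwa [realEmb_add_imagEmb])
  rw [realEmb_add_imagEmb] at this
  rw [S.mem_iff _ (F.map_target hζ₁), ← this]
  rfl

/-- A Levi-nondegenerate hypersurface invariant under the straightened fields is equivalent to a
tube over an affinely homogeneous base. -/
theorem exists_tube (S : IsStraightening Φ M p U ρ E F)
    (hE : ∀ y y' Z, ∃ s, ⁅E y, ⁅E y', Z⁆⁆ = E s) (hM : ¬ LeviDegenerateAt M p) :
    ∃ (Γ : Set R3) (q : C3), AffinelyHomogeneousAt Γ (rePart q) ∧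
      LeviNondegenerateAt (tube Γ) q ∧ HolomorphicallyEquivalentAt M p (tube Γ) q := by
  obtain ⟨r, hr, hball, htube⟩ := S.exists_ball_mem_tube_iff
  have hdef := isDefiningFunctionAt_tube (q := 0) S.isDefiningFunctionAt_base
  let F' : OpenPartialHomeomorph C3 C3 := F.restrOpen (F.source ∩ F ⁻¹' Metric.ball 0 r)
    (F.isOpen_inter_preimage Metric.isOpen_ball)
  have hmem : ∀ z ∈ F'.source,
      (z ∈ M ↔ F z ∈ tube {x | Φ (F.symm (realEmb x)) = 0}) := fun z hz => by
    rw [← htube (F z) hz.2.2, F.left_inv hz.1]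
  have hp : p ∈ F'.source := by
    refine ⟨S.mem_source, S.mem_source, ?_⟩
    rw [Set.mem_preimage, S.map_eq_zero]
    exact Metric.mem_ball_self hr
  refine ⟨_, 0, S.affinelyHomogeneousAt hE, ⟨_, hdef, fun hker => hM ?_⟩,
    F', hp, S.map_eq_zero, fun z hz => ?_, fun ζ hζ => ?_, hmem⟩
  -- A Levi kernel of the tube pulls back along `F` to one of `M`, for the pulled-back defining
  -- function. Degeneracy asks only for some defining function, so none needs to be compared with
  -- `Φ`.
  · obtain ⟨T, hT⟩ := S.exists_equiv p S.mem_source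
    have han := S.analyticAt p S.mem_source
    rw [← S.map_eq_zero] at hdef hker
    refine ⟨_, hdef.comp_holomorphic han hT ?_, HasLeviKernel.comp_holomorphic
      (Ψ := fun z => Φ (F.symm (realEmb (reCLM z)))) hdef.analyticAt han hT hker⟩
    filter_upwards [F'.open_source.mem_nhds hp] with z hz
    exact hmem z hz
  · exact (S.analyticAt z hz.1).differentiableAt.differentiableWithinAt
  · exact (S.analyticAt_symm hζ.1).differentiableAt.differentiableWithinAt

end IsStraightening

end Tube

/-! ### Block IV -/

section BlockIV

variable {L : Type*} [LieRing L] [LieAlgebra ℝ L] {e : Module.Basis (Fin 5) ℝ L}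

theorem IsAdaptedBasis.lie_mem_span (he : IsAdaptedBasis e) {Y Z : L} (hY : Y ∈ heisenbergPart e)
    (hZ : Z ∈ heisenbergPart e) : ∃ s : ℝ, ⁅Y, Z⁆ = s • e 0 := by
  suffices h : ⁅Y, Z⁆ ∈ Submodule.span ℝ {e 0} by
    obtain ⟨s, hs⟩ := Submodule.mem_span_singleton.1 h
    exact ⟨s, hs.symm⟩
  have h10 : ⁅e 1, e 0⁆ = 0 := by rw [← lie_skew, he.lie_zero_one, neg_zero]
  have h20 : ⁅e 2, e 0⁆ = 0 := by rw [← lie_skew, he.lie_zero_two, neg_zero]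
  have h21 : ⁅e 2, e 1⁆ = -e 0 := by rw [← lie_skew, he.lie_one_two]
  have h31 : ⁅e 3, e 1⁆ = 0 := by rw [← lie_skew, he.lie_one_three, neg_zero]
  have h30 : ⁅e 3, e 0⁆ = 0 := by rw [← lie_skew, he.lie_zero_three, neg_zero]
  have h32 : ⁅e 3, e 2⁆ = 0 := by rw [← lie_skew, he.lie_two_three, neg_zero]
  have hmem := Submodule.mem_span_singleton_self (R := ℝ) (e 0)
  induction hY, hZ using Submodule.span_induction₂ with
  | mem_mem x y hx hy =>
    obtain ⟨i, rfl⟩ := hx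
    obtain ⟨j, rfl⟩ := hy
    fin_cases i <;> fin_cases j <;>
      simp [he.lie_zero_one, he.lie_zero_two, he.lie_zero_three, he.lie_one_two,
        he.lie_one_three, he.lie_two_three, h10, h20, h21, h31, h30, h32, hmem]
  | zero_left y _ => simp
  | zero_right x _ => simp
  | add_left x y z _ _ _ hx hy => rw [add_lie]; exact add_mem hx hy
  | add_right x y z _ _ _ hx hy => rw [lie_add]; exact add_mem hx hy
  | smul_left r x y _ _ h => rw [smul_lie]; exact Submodule.smul_mem _ r h
  | smul_right r x y _ _ h => rw [lie_smul]; exact Submodule.smul_mem _ r h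

theorem IsAdaptedBasis.exists_lie_lie_eq (he : IsAdaptedBasis e) {x : L}
    (hx : x ∈ heisenbergPart e) (y y' : R3) (Z : L) :
    ∃ s, ⁅Fintype.linearCombination ℝ ![x, e 0, e 3] y,
      ⁅Fintype.linearCombination ℝ ![x, e 0, e 3] y', Z⁆⁆ =
        Fintype.linearCombination ℝ ![x, e 0, e 3] s := by
  have hmem : ∀ y, Fintype.linearCombination ℝ ![x, e 0, e 3] y ∈ heisenbergPart e := by
    intro y
    rw [Fintype.linearCombination_apply]
    refine Submodule.sum_mem _ fun j _ => Submodule.smul_mem _ _ ?_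
    fin_cases j
    exacts [hx, (mem_heisenbergPart e).1, (mem_heisenbergPart e).2.2.2]
  obtain ⟨s, hs⟩ := he.lie_mem_span (hmem y) (he.lie_mem_heisenbergPart _ (hmem y') Z)
  -- The inner bracket stays in the Heisenberg ideal, so the outer one is a multiple of `e 0`, the
  -- entry with index 1 of the frame.
  exact ⟨Pi.single 1 s, by rw [hs, Fintype.linearCombination_apply_single]; rfl⟩

theorem IsRealizationAt.exists_tube_of_not_mem {Φ : C3 → ℝ} {M : Set C3} {p : C3} {U : Set C3}
    {ρ : L →ₗ[ℝ] (C3 → C3)} (h : IsRealizationAt Φ M p U ρ) (he : IsAdaptedBasis e) {x : L}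
    (hx : x ∈ heisenbergPart e) (hx0 : ⁅x, e 0⁆ = 0) (hx3 : ⁅x, e 3⁆ = 0)
    (hli : LinearIndependent ℂ ![ρ (e 0) p, ρ (e 3) p])
    (hxp : ρ x p ∉ Submodule.span ℂ {ρ (e 0) p, ρ (e 3) p}) (hM : ¬ LeviDegenerateAt M p) :
    ∃ (Γ : Set R3) (q : C3), AffinelyHomogeneousAt Γ (rePart q) ∧
      LeviNondegenerateAt (tube Γ) q ∧ HolomorphicallyEquivalentAt M p (tube Γ) q := by
  have hli' : LinearIndependent ℂ fun j => ρ (![x, e 0, e 3] j) p := by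
    have h1 : (fun j => ρ (![x, e 0, e 3] j) p) =
        Fin.cons (ρ x p) ![ρ (e 0) p, ρ (e 3) p] := by
      funext j
      fin_cases j <;> rfl
    rw [h1, linearIndependent_finCons]
    refine ⟨hli, ?_⟩
    simpa [Matrix.range_cons, Set.pair_comm] using hxp
  have h0x : ⁅e 0, x⁆ = 0 := by rw [← lie_skew, hx0, neg_zero]
  have h3x : ⁅e 3, x⁆ = 0 := by rw [← lie_skew, hx3, neg_zero]
  have h30 : ⁅e 3, e 0⁆ = 0 := by rw [← lie_skew, he.lie_zero_three, neg_zero]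
  obtain ⟨F, S⟩ := h.exists_isStraightening (b := ![x, e 0, e 3]) (fun i j => by
    fin_cases i <;> fin_cases j <;> simp [h0x, h3x, h30, hx0, hx3, he.lie_zero_three]) hli'
  exact S.exists_tube (he.exists_lie_lie_eq hx) hM

theorem IsRealizationAt.leviDegenerateAt_or_exists_tube {Φ : C3 → ℝ} {M : Set C3} {p : C3}
    {U : Set C3} {ρ : L →ₗ[ℝ] (C3 → C3)} (h : IsRealizationAt Φ M p U ρ)
    (he : IsAdaptedBasis e) :
    LeviDegenerateAt M p ∨ ∃ (Γ : Set R3) (q : C3), AffinelyHomogeneousAt Γ (rePart q) ∧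
      LeviNondegenerateAt (tube Γ) q ∧ HolomorphicallyEquivalentAt M p (tube Γ) q := by
  have hL : Module.finrank ℝ L = 5 := by simp [Module.finrank_eq_card_basis e]
  have h0 : ρ (e 0) p ≠ 0 := fun h0 => e.ne_zero 0 (h.eq_zero_of_apply_eq_zero hL h0)
  refine or_iff_not_imp_left.2 fun hM => ?_
  have hli : LinearIndependent ℂ ![ρ (e 0) p, ρ (e 3) p] := by
    rw [LinearIndependent.pair_iff' h0]
    intro c hc
    by_cases him : c.im = 0
    -- A real ratio would give a nonzero element of `L` vanishing at `p`.
    · have h1 : e 3 - c.re • e 0 = 0 := by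
        refine h.eq_zero_of_apply_eq_zero hL ?_
        have h2 : (c.re : ℂ) = c := Complex.ext (by simp) (by simp [him])
        rw [map_sub, map_smul, Pi.sub_apply, Pi.smul_apply, ← hc, sub_eq_zero]
        nth_rewrite 1 [← h2]
        rfl
      have h2 := congrArg (fun x => e.repr x 3) h1
      simp at h2
    · exact hM (h.leviDegenerateAt he him h0 hc.symm)
  obtain ⟨-, h1, h2, -⟩ := mem_heisenbergPart e
  rcases h.not_mem_span_pair he h0 with hx | hx
  · refine h.exists_tube_of_not_mem he h1 ?_ he.lie_one_three hli hx hM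
    rw [← lie_skew, he.lie_zero_one, neg_zero]
  · refine h.exists_tube_of_not_mem he h2 ?_ he.lie_two_three hli hx hM
    rw [← lie_skew, he.lie_zero_two, neg_zero]

end BlockIV

end CRHyp

theorem mainTheorem3 {L : Type*} [LieRing L] [LieAlgebra ℝ L] (hL : CRHyp.IsBlockIV L) :
    (∃ I : LieIdeal ℝ L, CRHyp.IsHeisenbergPlusLine I) ∧
    ∀ (M : Set CRHyp.C3) (p : CRHyp.C3), CRHyp.IsAssociatedWith M p L →
      CRHyp.LeviDegenerateAt M p ∨
      ∃ (Γ : Set CRHyp.R3) (q : CRHyp.C3),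
        CRHyp.AffinelyHomogeneousAt Γ (CRHyp.rePart q) ∧
        CRHyp.LeviNondegenerateAt (CRHyp.tube Γ) q ∧
        CRHyp.HolomorphicallyEquivalentAt M p (CRHyp.tube Γ) q := by
  obtain ⟨e, he⟩ := hL.exists_isAdaptedBasis
  refine ⟨he.exists_ideal, fun M p hM => ?_⟩
  obtain ⟨Φ, U, ρ, h⟩ := hM.exists_isRealizationAt
  exact h.leviDegenerateAt_or_exists_tube he
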